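/- Let $\mathbb K$ be an algebraically closed field, let $n>2$ be an integer and let $q\in\mathbb K$ be a primitive $n$-th root of unity. Let $A_n(q)$ be the Taft Hopf algebra generated by $g,x$ with relations $g^n=1$, $x^n=0$, $xg=qgx$, and with $\Delta(g)=g\otimes g$, $\Delta(x)=x\otimes g+1\otimes x$, $\varepsilon(g)=1$, $\varepsilon(x)=0$, $S(g)=g^{n-1}$, $S(x)=-xg^{n-1}$; let $A_n(q^{-1})$ be the analogous Hopf algebra with generators $g_1,x_1$ and $q^{-1}$ in place of $q$. Let $\mathcal H_n(q)=A_n(q)\otimes A_n(q^{-1})$, and put $a=1\otimes x_1$, $b=1\otimes g_1$, $c=g\otimes 1$, $d=x\otimes 1$. For integers $i,j$ (modulo $n$) let $S_{i,j}$ be the one-dimensional left $\mathcal H_n(q)$-module on which $b$ acts by $q^i$, $c$ acts by $q^j$, and $a,d$ act by $0$; let $P_{0,0}$ be the projective cover of $S_{0,0}$. For a Hopf algebra $H$ over $\mathbb K$, the Green ring $r(H)$ is the abelian group generated by the isomorphism classes $[M]$ of finite-dimensional left $H$-modules modulo the relations $[M\oplus N]=[M]+[N]$, with multiplication $[M][N]=[M\otimes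 N]$, and the projective class ring $r_p(H)$ is the subring of $r(H)$ generated by the classes of the projective modules and of the simple modules. Then the projective cover $P_{0,0}$ exists as a finite-dimensional module, and there is a ring isomorphism $$\mathbb Z[x,y,z]\Big/\Big(x^n-1,\ y^n-1,\ z^2-\sum_{i,j=0}^{n-1}x^iy^jz\Big)\;\cong\; r_p(\mathcal H_n(q))$$ which sends the classes of $x,y,z$ to $[S_{1,0}]$, $[S_{0,1}]$ and $[P_{0,0}]$, respectively. -/

import Mathlib

set_option linter.unusedSimpArgs false

open scoped TensorProduct

universe u

noncomputable section

/-! ### Finite-dimensional modules over a bialgebra -/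

/-- A finite-dimensional left `H`-module over the field `K`. -/
structure FDMod (K H : Type u) [Field K] [Ring H] [Bialgebra K H] where
  carrier : Type u
  [addCommGroup : AddCommGroup carrier]
  [moduleBase : Module K carrier]
  [module : Module H carrier]
  [isScalarTower : IsScalarTower K H carrier]
  [finite : Module.Finite K carrier]

namespace FDMod

attribute [instance] addCommGroup moduleBase module isScalarTower finite

variable {K H : Type u} [Field K] [Ring H] [Bialgebra K H]

instance : CoeSort (FDMod K H) (Type u) := ⟨carrier⟩

/-- The `H`-module given by an algebra homomorphism `H → End V`. -/
def ofRep {V : Type u} [AddCommGroup V] [Module K V] [Module.Finite K V]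
    (ρ : H →ₐ[K] Module.End K V) : FDMod K H where
  carrier := V
  module := Module.compHom V ρ.toRingHom
  isScalarTower := by
    let _ : Module H V := Module.compHom V ρ.toRingHom
    refine ⟨fun k h v => ?_⟩
    change ρ (k • h) v = k • ρ h v
    rw [map_smul, LinearMap.smul_apply]

/-- The representation `H → End M` of a module `M`. -/
def rep (M : FDMod K H) : H →ₐ[K] Module.End K M := Algebra.lsmul K K M

/-- The one-dimensional module on which `H` acts by a character. -/
def ofCharacter (χ : H →ₐ[K] K) : FDMod K H :=
  ofRep ((Algebra.lsmul K K K : K →ₐ[K] Module.End K K).comp χ)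

/-- The trivial module: `H` acts through the counit. -/
def trivial (K H : Type u) [Field K] [Ring H] [Bialgebra K H] : FDMod K H :=
  ofCharacter (Bialgebra.counitAlgHom K H)

/-- The direct sum `M ⊕ N`. -/
def directSum (M N : FDMod K H) : FDMod K H where
  carrier := M × N

section tensorAction

variable {U V W : Type u} [AddCommGroup U] [Module K U] [AddCommGroup V] [Module K V]
  [AddCommGroup W] [Module K W]

/-- Given representations of `H` on `V` and `W`, the algebra `H ⊗ H` acts on `V ⊗ W` by
`(h ⊗ h') (v ⊗ w) = h v ⊗ h' w`. -/
def tensorAction (ρ : H →ₐ[K] Module.End K V) (σ : H →ₐ[K] Module.End K W) :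
    H ⊗[K] H →ₐ[K] Module.End K (V ⊗[K] W) :=
  (Module.endTensorEndAlgHom (R := K) (S := K) (A := K)).comp (Algebra.TensorProduct.map ρ σ)

@[simp]
theorem tensorAction_tmul_tmul (ρ : H →ₐ[K] Module.End K V) (σ : H →ₐ[K] Module.End K W)
    (h h' : H) (v : V) (w : W) :
    tensorAction ρ σ (h ⊗ₜ h') (v ⊗ₜ w) = ρ h v ⊗ₜ σ h' w := rfl

/-- The tensor product of two representations, where `h` acts on `V ⊗ W` through its
comultiplication: `h (v ⊗ w) = ∑ h₁ v ⊗ h₂ w`. -/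
def tensorRep (ρ : H →ₐ[K] Module.End K V) (σ : H →ₐ[K] Module.End K W) :
    H →ₐ[K] Module.End K (V ⊗[K] W) :=
  (tensorAction ρ σ).comp (Bialgebra.comulAlgHom K H)

theorem tensorRep_apply (ρ : H →ₐ[K] Module.End K V) (σ : H →ₐ[K] Module.End K W) (h : H) :
    tensorRep ρ σ h = tensorAction ρ σ (Coalgebra.comul h) := rfl

theorem tensorRep_congr {V' W' : Type u} [AddCommGroup V'] [Module K V'] [AddCommGroup W']
    [Module K W'] (ρ : H →ₐ[K] Module.End K V) (σ : H →ₐ[K] Module.End K W)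
    (ρ' : H →ₐ[K] Module.End K V') (σ' : H →ₐ[K] Module.End K W')
    (e : V ≃ₗ[K] V') (f : W ≃ₗ[K] W') (he : ∀ h v, e (ρ h v) = ρ' h (e v))
    (hf : ∀ h w, f (σ h w) = σ' h (f w)) (h : H) (m : V ⊗[K] W) :
    TensorProduct.congr e f (tensorRep ρ σ h m) =
      tensorRep ρ' σ' h (TensorProduct.congr e f m) := by
  rw [tensorRep_apply, tensorRep_apply]
  generalize (Coalgebra.comul h : H ⊗[K] H) = t
  induction t with
  | zero => simp
  | add s t hs ht => simp only [map_add, LinearMap.add_apply, hs, ht]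
  | tmul a b =>
    induction m with
    | zero => simp
    | add s t hs ht => simp only [map_add, hs, ht]
    | tmul x y => simp [he, hf]

theorem tensorRep_assoc (ρ : H →ₐ[K] Module.End K U) (σ : H →ₐ[K] Module.End K V)
    (τ : H →ₐ[K] Module.End K W) (h : H) (m : (U ⊗[K] V) ⊗[K] W) :
    TensorProduct.assoc K U V W (tensorRep (tensorRep ρ σ) τ h m) =
      tensorRep ρ (tensorRep σ τ) h (TensorProduct.assoc K U V W m) := by
  let Θ : H ⊗[K] (H ⊗[K] H) →ₐ[K] Module.End K (U ⊗[K] (V ⊗[K] W)) :=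
    (Module.endTensorEndAlgHom (R := K) (S := K) (A := K)).comp
      (Algebra.TensorProduct.map ρ (tensorAction σ τ))
  have hΘ : ∀ (a : H) (t : H ⊗[K] H) (u : U) (x : V ⊗[K] W),
      Θ (a ⊗ₜ t) (u ⊗ₜ x) = ρ a u ⊗ₜ tensorAction σ τ t x := fun _ _ _ _ => rfl
  have key1 : ∀ (t : H ⊗[K] H) (m : (U ⊗[K] V) ⊗[K] W),
      TensorProduct.assoc K U V W (tensorAction (tensorRep ρ σ) τ t m) =
      Θ (TensorProduct.assoc K H H H ((Coalgebra.comul (R := K)).rTensor H t))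
        (TensorProduct.assoc K U V W m) := by
    intro t m
    induction t with
    | zero => simp
    | add s t hs ht => simp only [map_add, LinearMap.add_apply, hs, ht]
    | tmul a b =>
      induction m with
      | zero => simp
      | add s t hs ht => simp only [map_add, hs, ht]
      | tmul x n =>
        rw [tensorAction_tmul_tmul, tensorRep_apply, LinearMap.rTensor_tmul]
        generalize (Coalgebra.comul a : H ⊗[K] H) = s
        induction s with
        | zero => simp
        | add s t hs ht => simp only [map_add, LinearMap.add_apply, TensorProduct.add_tmul, hs, ht]
        | tmul c d =>
          induction x with
          | zero => simp
          | add s t hs ht => simp only [map_add, TensorProduct.add_tmul, hs, ht]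
          | tmul l m => simp [hΘ]
  have key2 : ∀ (t : H ⊗[K] H) (m : U ⊗[K] (V ⊗[K] W)),
      tensorAction ρ (tensorRep σ τ) t m = Θ ((Coalgebra.comul (R := K)).lTensor H t) m := by
    intro t m
    induction t with
    | zero => simp
    | add s t hs ht => simp only [map_add, LinearMap.add_apply, hs, ht]
    | tmul a b =>
      induction m with
      | zero => simp
      | add s t hs ht => simp only [map_add, hs, ht]
      | tmul l x => simp [hΘ, tensorRep_apply]
  rw [tensorRep_apply, tensorRep_apply, key1, key2, Coalgebra.coassoc_apply]

theorem lid_tensorRep (σ : H →ₐ[K] Module.End K V) (h : H) (m : K ⊗[K] V) :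
    TensorProduct.lid K V (tensorRep
      ((Algebra.lsmul K K K : K →ₐ[K] Module.End K K).comp (Bialgebra.counitAlgHom K H)) σ h m) =
      σ h (TensorProduct.lid K V m) := by
  have key : ∀ (t : H ⊗[K] H) (m : K ⊗[K] V),
      TensorProduct.lid K V (tensorAction
        ((Algebra.lsmul K K K : K →ₐ[K] Module.End K K).comp (Bialgebra.counitAlgHom K H)) σ t m) =
      σ (TensorProduct.lid K H ((Coalgebra.counit (R := K)).rTensor H t))
        (TensorProduct.lid K V m) := by
    intro t m
    induction t with
    | zero => simp
    | add s t hs ht => simp only [map_add, LinearMap.add_apply, hs, ht]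
    | tmul a b =>
      induction m with
      | zero => simp
      | add s t hs ht => simp only [map_add, hs, ht]
      | tmul k x => simp [mul_smul, smul_comm k]
  rw [tensorRep_apply, key, Coalgebra.rTensor_counit_comul, TensorProduct.lid_tmul, one_smul]

theorem rid_tensorRep (σ : H →ₐ[K] Module.End K V) (h : H) (m : V ⊗[K] K) :
    TensorProduct.rid K V (tensorRep σ
      ((Algebra.lsmul K K K : K →ₐ[K] Module.End K K).comp (Bialgebra.counitAlgHom K H)) h m) =
      σ h (TensorProduct.rid K V m) := by
  have key : ∀ (t : H ⊗[K] H) (m : V ⊗[K] K),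
      TensorProduct.rid K V (tensorAction σ
        ((Algebra.lsmul K K K : K →ₐ[K] Module.End K K).comp (Bialgebra.counitAlgHom K H)) t m) =
      σ (TensorProduct.rid K H ((Coalgebra.counit (R := K)).lTensor H t))
        (TensorProduct.rid K V m) := by
    intro t m
    induction t with
    | zero => simp
    | add s t hs ht => simp only [map_add, LinearMap.add_apply, hs, ht]
    | tmul a b =>
      induction m with
      | zero => simp
      | add s t hs ht => simp only [map_add, hs, ht]
      | tmul x k => simp [mul_smul, smul_comm k]
  rw [tensorRep_apply, key, Coalgebra.lTensor_counit_comul, TensorProduct.rid_tmul, one_smul]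

/-- The direct sum of two representations. -/
def prodRep (ρ : H →ₐ[K] Module.End K V) (σ : H →ₐ[K] Module.End K W) :
    H →ₐ[K] Module.End K (V × W) :=
  (LinearMap.prodMapAlgHom K V W).comp (ρ.prod σ)

theorem prodRep_apply (ρ : H →ₐ[K] Module.End K V) (σ : H →ₐ[K] Module.End K W) (h : H)
    (v : V × W) : prodRep ρ σ h v = (ρ h v.1, σ h v.2) := rfl

theorem prodRight_tensorRep (ρ : H →ₐ[K] Module.End K U) (σ : H →ₐ[K] Module.End K V)
    (τ : H →ₐ[K] Module.End K W) (h : H) (m : U ⊗[K] (V × W)) :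
    TensorProduct.prodRight K K U V W (tensorRep ρ (prodRep σ τ) h m) =
      prodRep (tensorRep ρ σ) (tensorRep ρ τ) h (TensorProduct.prodRight K K U V W m) := by
  rw [prodRep_apply, tensorRep_apply, tensorRep_apply, tensorRep_apply]
  generalize (Coalgebra.comul h : H ⊗[K] H) = t
  induction t with
  | zero => simp only [map_zero, LinearMap.zero_apply, Prod.fst_zero, Prod.snd_zero,
        Prod.mk_zero_zero]
  | add s t hs ht => simp only [map_add, LinearMap.add_apply, hs, ht, Prod.mk_add_mk]
  | tmul a b =>
    induction m with
    | zero => simp only [map_zero, LinearMap.zero_apply, Prod.fst_zero, Prod.snd_zero,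
        Prod.mk_zero_zero]
    | add s t hs ht => simp only [map_add, hs, ht, Prod.fst_add, Prod.snd_add, Prod.mk_add_mk]
    | tmul l x => simp [prodRep_apply]

theorem prodLeft_tensorRep (ρ : H →ₐ[K] Module.End K U) (σ : H →ₐ[K] Module.End K V)
    (τ : H →ₐ[K] Module.End K W) (h : H) (m : (U × V) ⊗[K] W) :
    TensorProduct.prodLeft K K U V W (tensorRep (prodRep ρ σ) τ h m) =
      prodRep (tensorRep ρ τ) (tensorRep σ τ) h (TensorProduct.prodLeft K K U V W m) := by
  rw [prodRep_apply, tensorRep_apply, tensorRep_apply, tensorRep_apply]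
  generalize (Coalgebra.comul h : H ⊗[K] H) = t
  induction t with
  | zero => simp only [map_zero, LinearMap.zero_apply, Prod.fst_zero, Prod.snd_zero,
        Prod.mk_zero_zero]
  | add s t hs ht => simp only [map_add, LinearMap.add_apply, hs, ht, Prod.mk_add_mk]
  | tmul a b =>
    induction m with
    | zero => simp only [map_zero, LinearMap.zero_apply, Prod.fst_zero, Prod.snd_zero,
        Prod.mk_zero_zero]
    | add s t hs ht => simp only [map_add, hs, ht, Prod.fst_add, Prod.snd_add, Prod.mk_add_mk]
    | tmul l x => rfl

end tensorAction

/-- The tensor product `M ⊗ N` over `K`, where `h` acts through its comultiplication: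
`h (m ⊗ n) = ∑ h₁ m ⊗ h₂ n`. -/
def tensor (M N : FDMod K H) : FDMod K H := ofRep (tensorRep M.rep N.rep)

/-- A `K`-linear bijection that commutes with `H` is an isomorphism of modules. -/
def isoOfLinearEquiv {M N : FDMod K H} (e : M ≃ₗ[K] N)
    (he : ∀ (h : H) (m : M), e (h • m) = h • e m) : M ≃ₗ[H] N :=
  { e with map_smul' := he }

theorem tensor_congr {M M' N N' : FDMod K H} (e : M ≃ₗ[H] M') (f : N ≃ₗ[H] N') :
    Nonempty (tensor M N ≃ₗ[H] tensor M' N') :=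
  ⟨isoOfLinearEquiv (M := tensor M N) (N := tensor M' N')
    (TensorProduct.congr (e.restrictScalars K) (f.restrictScalars K))
    (tensorRep_congr M.rep N.rep M'.rep N'.rep (e.restrictScalars K) (f.restrictScalars K)
      (fun h v => e.map_smul h v) (fun h v => f.map_smul h v))⟩

theorem tensor_assoc (L M N : FDMod K H) :
    Nonempty (tensor (tensor L M) N ≃ₗ[H] tensor L (tensor M N)) :=
  ⟨isoOfLinearEquiv (M := tensor (tensor L M) N) (N := tensor L (tensor M N))
    (TensorProduct.assoc K L M N) (tensorRep_assoc L.rep M.rep N.rep)⟩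

theorem trivial_tensor (M : FDMod K H) : Nonempty (tensor (trivial K H) M ≃ₗ[H] M) :=
  ⟨isoOfLinearEquiv (M := tensor (trivial K H) M) (TensorProduct.lid K M) (lid_tensorRep M.rep)⟩

theorem tensor_trivial (M : FDMod K H) : Nonempty (tensor M (trivial K H) ≃ₗ[H] M) :=
  ⟨isoOfLinearEquiv (M := tensor M (trivial K H)) (TensorProduct.rid K M) (rid_tensorRep M.rep)⟩

theorem tensor_directSum (L M N : FDMod K H) :
    Nonempty (tensor L (directSum M N) ≃ₗ[H] directSum (tensor L M) (tensor L N)) :=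
  ⟨isoOfLinearEquiv (M := tensor L (directSum M N)) (N := directSum (tensor L M) (tensor L N))
    (TensorProduct.prodRight K K L M N) (prodRight_tensorRep L.rep M.rep N.rep)⟩

theorem directSum_tensor (L M N : FDMod K H) :
    Nonempty (tensor (directSum L M) N ≃ₗ[H] directSum (tensor L N) (tensor M N)) :=
  ⟨isoOfLinearEquiv (M := tensor (directSum L M) N) (N := directSum (tensor L N) (tensor M N))
    (TensorProduct.prodLeft K K L M N) (prodLeft_tensorRep L.rep M.rep N.rep)⟩

/-- Isomorphism of `H`-modules. -/
instance isoSetoid (K H : Type u) [Field K] [Ring H] [Bialgebra K H] : Setoid (FDMod K H) where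
  r M N := Nonempty (M ≃ₗ[H] N)
  iseqv := ⟨fun _ => ⟨LinearEquiv.refl _ _⟩, fun ⟨e⟩ => ⟨e.symm⟩, fun ⟨e⟩ ⟨f⟩ => ⟨e.trans f⟩⟩

end FDMod

/-! ### The Green ring and the projective class ring -/

/-- Isomorphism classes of finite-dimensional `H`-modules. -/
def IsoClass (K H : Type u) [Field K] [Ring H] [Bialgebra K H] : Type (u + 1) :=
  Quotient (FDMod.isoSetoid K H)

namespace IsoClass

variable {K H : Type u} [Field K] [Ring H] [Bialgebra K H]

/-- The isomorphism class of a module. -/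
def mk (M : FDMod K H) : IsoClass K H := Quotient.mk _ M

/-- Isomorphism classes form a monoid under the tensor product. -/
instance : Monoid (IsoClass K H) where
  mul := Quotient.map₂ FDMod.tensor fun _ _ ⟨e⟩ _ _ ⟨f⟩ => FDMod.tensor_congr e f
  one := mk (FDMod.trivial K H)
  mul_assoc := by
    rintro ⟨L⟩ ⟨M⟩ ⟨N⟩
    exact Quotient.sound (FDMod.tensor_assoc L M N)
  one_mul := by
    rintro ⟨M⟩
    exact Quotient.sound (FDMod.trivial_tensor M)
  mul_one := by
    rintro ⟨M⟩
    exact Quotient.sound (FDMod.tensor_trivial M)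

theorem mk_surjective : Function.Surjective (mk (K := K) (H := H)) := Quotient.mk_surjective

theorem mk_mul_mk (M N : FDMod K H) : mk M * mk N = mk (M.tensor N) := rfl

end IsoClass

section GreenRing

variable (K H : Type u) [Field K] [Ring H] [Bialgebra K H]

/-- The elements `[M ⊕ N] - [M] - [N]` of the free abelian group on isomorphism classes. -/
def greenRelations : Set (FreeAbelianGroup (IsoClass K H)) :=
  {r | ∃ M N : FDMod K H, r = FreeAbelianGroup.of (IsoClass.mk (M.directSum N)) -
    FreeAbelianGroup.of (IsoClass.mk M) - FreeAbelianGroup.of (IsoClass.mk N)}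

variable {K H}

theorem mul_mem_closure_greenRelations (a r : FreeAbelianGroup (IsoClass K H))
    (hr : r ∈ AddSubgroup.closure (greenRelations K H)) :
    a * r ∈ AddSubgroup.closure (greenRelations K H) := by
  induction hr using AddSubgroup.closure_induction with
  | zero => simp
  | add x y _ _ hx hy => rw [mul_add]; exact add_mem hx hy
  | neg x _ hx => rw [mul_neg]; exact neg_mem hx
  | mem x hx =>
    obtain ⟨M, N, rfl⟩ := hx
    induction a using FreeAbelianGroup.induction_on with
    | zero => simp
    | neg x hx => rw [neg_mul]; exact neg_mem hx
    | add x y hx hy => rw [add_mul]; exact add_mem hx hy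
    | of x =>
      obtain ⟨L, rfl⟩ := IsoClass.mk_surjective x
      refine AddSubgroup.subset_closure ⟨L.tensor M, L.tensor N, ?_⟩
      rw [mul_sub, mul_sub]
      simp only [FreeAbelianGroup.of_mul_of, IsoClass.mk_mul_mk]
      congr 3
      exact Quotient.sound (FDMod.tensor_directSum L M N)

theorem mul_mem_closure_greenRelations' (a r : FreeAbelianGroup (IsoClass K H))
    (hr : r ∈ AddSubgroup.closure (greenRelations K H)) :
    r * a ∈ AddSubgroup.closure (greenRelations K H) := by
  induction hr using AddSubgroup.closure_induction with
  | zero => simp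
  | add x y _ _ hx hy => rw [add_mul]; exact add_mem hx hy
  | neg x _ hx => rw [neg_mul]; exact neg_mem hx
  | mem x hx =>
    obtain ⟨M, N, rfl⟩ := hx
    induction a using FreeAbelianGroup.induction_on with
    | zero => simp
    | neg x hx => rw [mul_neg]; exact neg_mem hx
    | add x y hx hy => rw [mul_add]; exact add_mem hx hy
    | of x =>
      obtain ⟨L, rfl⟩ := IsoClass.mk_surjective x
      refine AddSubgroup.subset_closure ⟨M.tensor L, N.tensor L, ?_⟩
      rw [sub_mul, sub_mul]
      simp only [FreeAbelianGroup.of_mul_of, IsoClass.mk_mul_mk]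
      congr 3
      exact Quotient.sound (FDMod.directSum_tensor M N L)

variable (K H)

/-- The subgroup generated by all `[M ⊕ N] - [M] - [N]`; it is a two-sided ideal for the
multiplication `[M] [N] = [M ⊗ N]`. -/
def greenIdeal : Ideal (FreeAbelianGroup (IsoClass K H)) where
  carrier := AddSubgroup.closure (greenRelations K H)
  add_mem' := add_mem
  zero_mem' := zero_mem _
  smul_mem' a r hr := mul_mem_closure_greenRelations a r hr

instance : (greenIdeal K H).IsTwoSided :=
  ⟨fun b hr => mul_mem_closure_greenRelations' b _ hr⟩

/-- The Green ring `r(H)`: the abelian group generated by the isomorphism classes of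
finite-dimensional modules modulo `[M ⊕ N] = [M] + [N]`, with `[M] [N] = [M ⊗ N]`. -/
abbrev GreenRing : Type (u + 1) := FreeAbelianGroup (IsoClass K H) ⧸ greenIdeal K H

variable {K H}

/-- The class `[M]` in the Green ring. -/
def greenClass (M : FDMod K H) : GreenRing K H :=
  Ideal.Quotient.mk (greenIdeal K H) (FreeAbelianGroup.of (IsoClass.mk M))

theorem greenClass_mul (M N : FDMod K H) :
    greenClass M * greenClass N = greenClass (M.tensor N) := by
  rw [greenClass, greenClass, ← map_mul, FreeAbelianGroup.of_mul_of]; rfl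

theorem greenClass_add (M N : FDMod K H) :
    greenClass (M.directSum N) = greenClass M + greenClass N := by
  rw [← sub_eq_zero, ← sub_sub, greenClass, greenClass, greenClass, ← map_sub, ← map_sub,
    Ideal.Quotient.eq_zero_iff_mem]
  exact AddSubgroup.subset_closure ⟨M, N, rfl⟩

variable (K H)

/-- The projective class ring `r_p(H)`: the subring of the Green ring generated by the classes of
projective modules and of simple modules. -/
def projectiveClassRing : Subring (GreenRing K H) :=
  Subring.closure {r | ∃ M : FDMod K H,
    (Module.Projective H M ∨ IsSimpleModule H M) ∧ r = greenClass M}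

end GreenRing

/-- `π : P → M` is a projective cover: `P` is projective, `π` is surjective, and the kernel of `π`
is superfluous. -/
structure IsProjectiveCover {R P M : Type*} [Ring R] [AddCommGroup P] [Module R P]
    [AddCommGroup M] [Module R M] (π : P →ₗ[R] M) : Prop where
  projective : Module.Projective R P
  surjective : Function.Surjective π
  superfluous : ∀ N : Submodule R P, N ⊔ LinearMap.ker π = ⊤ → N = ⊤

/-! ### Taft algebras -/

/-- If `b a = q a b` and `q` is a primitive `n`-th root of unity, then
`(a + b)^n = a^n + b^n`. -/
theorem add_pow_of_qCommute {K A : Type*} [Field K] [Ring A] [Algebra K A] {q : K} {n : ℕ}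
    (hn : n ≠ 0) (hq : IsPrimitiveRoot q n) {a b : A} (hab : b * a = q • (a * b)) :
    (a + b) ^ n = a ^ n + b ^ n := by
  classical
  -- Gaussian binomial coefficients
  obtain ⟨c, c0, cs0, cs⟩ : ∃ c : ℕ → ℕ → K, (∀ k, c 0 k = if k = 0 then 1 else 0) ∧
      (∀ m, c (m + 1) 0 = c m 0) ∧
      ∀ m k, c (m + 1) (k + 1) = c m k + q ^ (k + 1) * c m (k + 1) :=
    ⟨fun m => Nat.rec (fun k => if k = 0 then 1 else 0)
      (fun _ f k => Nat.casesOn k (f 0) fun j => f j + q ^ (j + 1) * f (j + 1)) m,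
      fun _ => rfl, fun _ => rfl, fun _ _ => rfl⟩
  have cm0 : ∀ m, c m 0 = 1 := by
    intro m; induction m with
    | zero => simp [c0]
    | succ m ih => rw [cs0, ih]
  have cgt : ∀ m k, m < k → c m k = 0 := by
    intro m; induction m with
    | zero => intro k hk; simp [c0, hk.ne']
    | succ m ih =>
      intro k hk
      obtain ⟨k, rfl⟩ : ∃ j, k = j + 1 := ⟨k - 1, by omega⟩
      rw [cs, ih k (by omega), ih (k + 1) (by omega)]; simp
  have cmm : ∀ m, c m m = 1 := by
    intro m; induction m with
    | zero => simp [c0]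
    | succ m ih => rw [cs, ih, cgt m (m + 1) (by omega)]; simp
  -- `(1 - q^(k+1)) [m+1, k+1] = (1 - q^(m+1)) [m, k]`
  have cmul : ∀ m k, (1 - q ^ (k + 1)) * c (m + 1) (k + 1) = (1 - q ^ (m + 1)) * c m k := by
    intro m; induction m with
    | zero =>
      intro k
      rw [cs]
      cases k with
      | zero => simp [c0]
      | succ k => simp [c0]
    | succ m ih =>
      intro k
      have h1 := ih k
      cases k with
      | zero =>
        rw [cs, cm0]
        rw [cm0] at h1
        linear_combination q ^ (0 + 1) * h1
      | succ k =>
        have h2 := ih k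
        have h3 := cs m k
        rw [cs (m + 1) (k + 1)]
        linear_combination q ^ (k + 2) * h1 + q * h2 - q * (1 - q ^ (m + 1)) * h3
  have bpow : ∀ k, b * a ^ k = q ^ k • (a ^ k * b) := by
    intro k; induction k with
    | zero => simp
    | succ k ih =>
      rw [pow_succ, ← mul_assoc, ih, smul_mul_assoc, mul_assoc, hab, mul_smul_comm, smul_smul,
        ← pow_succ, ← mul_assoc]
  have expand : ∀ m, (a + b) ^ m = ∑ k ∈ Finset.range (m + 1), c m k • (a ^ k * b ^ (m - k)) := by
    intro m; induction m with
    | zero => simp [c0]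
    | succ m ih =>
      rw [pow_succ', ih, add_mul, Finset.mul_sum, Finset.mul_sum]
      rw [Finset.sum_range_succ' _ (m + 1)]
      have e1 : ∀ k ∈ Finset.range (m + 1), a * (c m k • (a ^ k * b ^ (m - k))) =
          c m k • (a ^ (k + 1) * b ^ (m - k)) := by
        intro k _; rw [mul_smul_comm, ← mul_assoc, ← pow_succ']
      have e2 : ∀ k ∈ Finset.range (m + 1), b * (c m k • (a ^ k * b ^ (m - k))) =
          (q ^ k * c m k) • (a ^ k * b ^ (m + 1 - k)) := by
        intro k hk
        have : m + 1 - k = (m - k) + 1 := by have := Finset.mem_range.mp hk; omega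
        rw [this, mul_smul_comm, ← mul_assoc, bpow, smul_mul_assoc, mul_assoc, ← pow_succ',
          smul_smul, mul_comm]
      rw [Finset.sum_congr rfl e1, Finset.sum_congr rfl e2]
      have e3 : ∀ k ∈ Finset.range (m + 1),
          c (m + 1) (k + 1) • (a ^ (k + 1) * b ^ (m + 1 - (k + 1))) =
          c m k • (a ^ (k + 1) * b ^ (m - k)) +
            (q ^ (k + 1) * c m (k + 1)) • (a ^ (k + 1) * b ^ (m + 1 - (k + 1))) := by
        intro k _; rw [cs, add_smul, Nat.add_sub_add_right]
      rw [Finset.sum_congr rfl e3, Finset.sum_add_distrib, add_assoc]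
      congr 1
      rw [Finset.sum_range_succ' _ m, Finset.sum_range_succ _ m, cgt m (m + 1) (by omega)]
      simp [cs0]
  rw [expand, Finset.sum_range_succ, Nat.sub_self, pow_zero, mul_one, cmm, one_smul]
  obtain ⟨n, rfl⟩ : ∃ j, n = j + 1 := ⟨n - 1, by omega⟩
  rw [Finset.sum_range_succ', cm0, pow_zero, one_mul, one_smul, Nat.sub_zero,
    Finset.sum_eq_zero, zero_add, add_comm]
  intro k hk
  have hk := Finset.mem_range.mp hk
  have h := cmul n k
  rw [hq.pow_eq_one, sub_self, zero_mul] at h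
  rcases mul_eq_zero.mp h with h | h
  · exact absurd (sub_eq_zero.mp h).symm (hq.pow_ne_one_of_pos_of_lt (by omega) (by omega))
  · rw [h, zero_smul]

/-- If `x u = c u x` and `x^m = 0` then `(x u)^m = 0`. -/
theorem mul_pow_eq_zero_of_qCommute {K A : Type*} [Field K] [Ring A] [Algebra K A] {c : K} {m : ℕ}
    {x u : A} (h : u * x = c • (x * u)) (hx : x ^ m = 0) : (x * u) ^ m = 0 := by
  have h1 : ∀ k, u ^ k * x = c ^ k • (x * u ^ k) := by
    intro k; induction k with
    | zero => simp
    | succ k ih =>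
      rw [pow_succ, mul_assoc, h, mul_smul_comm, ← mul_assoc, ih, smul_mul_assoc, smul_smul,
        ← pow_succ', mul_assoc, ← pow_succ]
  have h2 : ∀ k, ∃ d : K, (x * u) ^ k = d • (x ^ k * u ^ k) := by
    intro k; induction k with
    | zero => exact ⟨1, by simp⟩
    | succ k ih =>
      obtain ⟨d, hd⟩ := ih
      refine ⟨d * c ^ k, ?_⟩
      rw [pow_succ, hd, smul_mul_assoc, mul_assoc, ← mul_assoc (u ^ k), h1, smul_mul_assoc,
        mul_smul_comm, smul_smul, mul_assoc, ← mul_assoc (x ^ k), ← pow_succ, ← pow_succ]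
  obtain ⟨d, hd⟩ := h2 m
  rw [hd, hx, zero_mul, smul_zero]

/-- The generators of a Taft algebra. -/
inductive TaftGen : Type
  | g
  | x

/-- The relations `g^n = 1`, `x^n = 0`, `x g = q g x`. -/
inductive TaftRel (K : Type u) [Field K] (n : ℕ) (q : K) :
    FreeAlgebra K TaftGen → FreeAlgebra K TaftGen → Prop
  | g_pow : TaftRel K n q (FreeAlgebra.ι K TaftGen.g ^ n) 1
  | x_pow : TaftRel K n q (FreeAlgebra.ι K TaftGen.x ^ n) 0
  | x_mul_g : TaftRel K n q (FreeAlgebra.ι K TaftGen.x * FreeAlgebra.ι K TaftGen.g)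
      (q • (FreeAlgebra.ι K TaftGen.g * FreeAlgebra.ι K TaftGen.x))

/-- The Taft algebra `A_n(q)`, generated by `g` and `x` with relations
`g^n = 1`, `x^n = 0`, `x g = q g x`. -/
def Taft (K : Type u) [Field K] (n : ℕ) (q : K) : Type u := RingQuot (TaftRel K n q)

namespace Taft

variable {K : Type u} [Field K] {n : ℕ} {q : K}

instance : Ring (Taft K n q) := inferInstanceAs (Ring (RingQuot (TaftRel K n q)))

instance : Algebra K (Taft K n q) := inferInstanceAs (Algebra K (RingQuot (TaftRel K n q)))

variable (K n q) in
/-- The quotient map from the free algebra. -/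
def mkHom : FreeAlgebra K TaftGen →ₐ[K] Taft K n q := RingQuot.mkAlgHom K (TaftRel K n q)

variable (K n q) in
/-- The generator `g`. -/
def g : Taft K n q := mkHom K n q (FreeAlgebra.ι K TaftGen.g)

variable (K n q) in
/-- The generator `x`. -/
def x : Taft K n q := mkHom K n q (FreeAlgebra.ι K TaftGen.x)

theorem g_pow : g K n q ^ n = 1 := by
  have := RingQuot.mkAlgHom_rel K (TaftRel.g_pow (K := K) (n := n) (q := q))
  rwa [map_pow, map_one] at this

theorem x_pow : x K n q ^ n = 0 := by
  have := RingQuot.mkAlgHom_rel K (TaftRel.x_pow (K := K) (n := n) (q := q))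
  rwa [map_pow, map_zero] at this

theorem x_mul_g : x K n q * g K n q = q • (g K n q * x K n q) := by
  have := RingQuot.mkAlgHom_rel K (TaftRel.x_mul_g (K := K) (n := n) (q := q))
  rwa [map_mul, map_smul, map_mul] at this

/-- The universal property of the Taft algebra. -/
def lift {B : Type*} [Ring B] [Algebra K B] (G X : B) (hG : G ^ n = 1) (hX : X ^ n = 0)
    (hXG : X * G = q • (G * X)) : Taft K n q →ₐ[K] B :=
  RingQuot.liftAlgHom K ⟨FreeAlgebra.lift K fun t => TaftGen.casesOn t G X, by
    intro a b h
    cases h <;> simp [hG, hX, hXG]⟩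

section lift

variable {B : Type*} [Ring B] [Algebra K B] (G X : B) (hG : G ^ n = 1) (hX : X ^ n = 0)
    (hXG : X * G = q • (G * X))

@[simp]
theorem lift_g : lift G X hG hX hXG (g K n q) = G := by
  refine (RingQuot.liftAlgHom_mkAlgHom_apply K _ _ _).trans ?_
  simp

@[simp]
theorem lift_x : lift G X hG hX hXG (x K n q) = X := by
  refine (RingQuot.liftAlgHom_mkAlgHom_apply K _ _ _).trans ?_
  simp

end lift

theorem algHom_ext {B : Type*} [Semiring B] [Algebra K B] {φ ψ : Taft K n q →ₐ[K] B}
    (hg : φ (g K n q) = ψ (g K n q)) (hx : φ (x K n q) = ψ (x K n q)) : φ = ψ := by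
  refine RingQuot.ringQuot_ext' (s := TaftRel K n q) K φ ψ ?_
  refine FreeAlgebra.hom_ext (funext fun t => ?_)
  cases t
  · exact hg
  · exact hx

theorem induction {P : Taft K n q → Prop} (hr : ∀ r : K, P (algebraMap K _ r))
    (hg : P (g K n q)) (hx : P (x K n q)) (hadd : ∀ a b, P a → P b → P (a + b))
    (hmul : ∀ a b, P a → P b → P (a * b)) (t : Taft K n q) : P t := by
  obtain ⟨f, rfl⟩ := RingQuot.mkAlgHom_surjective K (TaftRel K n q) t
  change P (mkHom K n q f)
  induction f using FreeAlgebra.induction with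
  | grade0 r => rw [AlgHom.commutes]; exact hr r
  | grade1 t => cases t; exacts [hg, hx]
  | mul a b ha hb => rw [map_mul]; exact hmul _ _ ha hb
  | add a b ha hb => rw [map_add]; exact hadd _ _ ha hb

variable (K n q) in
/-- The counit: `ε(g) = 1`, `ε(x) = 0`. -/
def counitHom [NeZero n] : Taft K n q →ₐ[K] K :=
  lift 1 0 (one_pow n) (zero_pow (NeZero.ne n)) (by simp)

variable (K n q) in
/-- The comultiplication: `Δ(g) = g ⊗ g`, `Δ(x) = x ⊗ g + 1 ⊗ x`. -/
def comulHom [NeZero n] [hq : Fact (IsPrimitiveRoot q n)] :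
    Taft K n q →ₐ[K] Taft K n q ⊗[K] Taft K n q :=
  lift (g K n q ⊗ₜ g K n q) (x K n q ⊗ₜ g K n q + 1 ⊗ₜ x K n q)
    (by rw [Algebra.TensorProduct.tmul_pow, g_pow, Algebra.TensorProduct.one_def])
    (by
      rw [add_pow_of_qCommute (NeZero.ne n) hq.out, Algebra.TensorProduct.tmul_pow,
        Algebra.TensorProduct.tmul_pow, x_pow, TensorProduct.zero_tmul, TensorProduct.tmul_zero,
        add_zero]
      rw [Algebra.TensorProduct.tmul_mul_tmul, Algebra.TensorProduct.tmul_mul_tmul, x_mul_g,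
        one_mul, mul_one, TensorProduct.tmul_smul])
    (by
      simp only [add_mul, mul_add, Algebra.TensorProduct.tmul_mul_tmul, x_mul_g, one_mul, mul_one,
        TensorProduct.tmul_smul, TensorProduct.smul_tmul', smul_add])

instance [NeZero n] [Fact (IsPrimitiveRoot q n)] : Bialgebra K (Taft K n q) :=
  Bialgebra.ofAlgHom (comulHom K n q) (counitHom K n q)
    (by
      apply algHom_ext
      · simp [comulHom]
      · simp [comulHom, TensorProduct.add_tmul, TensorProduct.tmul_add,
          Algebra.TensorProduct.one_def, add_assoc])
    (by apply algHom_ext <;> simp [comulHom, counitHom])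
    (by apply algHom_ext <;> simp [comulHom, counitHom])

theorem pred_pow_mul [NeZero n] : g K n q ^ (n - 1) * g K n q = 1 := by
  rw [← pow_succ, Nat.sub_add_cancel (NeZero.one_le), g_pow]

theorem mul_pred_pow [NeZero n] : g K n q * g K n q ^ (n - 1) = 1 := by
  rw [← pow_succ', Nat.sub_add_cancel (NeZero.one_le), g_pow]

theorem pred_pow_mul_x [NeZero n] :
    g K n q ^ (n - 1) * x K n q = q • (x K n q * g K n q ^ (n - 1)) := by
  calc g K n q ^ (n - 1) * x K n q
      = g K n q ^ (n - 1) * (x K n q * g K n q) * g K n q ^ (n - 1) := by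
        rw [mul_assoc, mul_assoc, mul_pred_pow, mul_one]
    _ = q • (x K n q * g K n q ^ (n - 1)) := by
        rw [x_mul_g, mul_smul_comm, ← mul_assoc, pred_pow_mul, one_mul, smul_mul_assoc]

variable (K n q) in
/-- The antipode, an algebra anti-homomorphism: `S(g) = g^(n-1)`, `S(x) = - x g^(n-1)`. -/
def antipodeHom [NeZero n] : Taft K n q →ₐ[K] (Taft K n q)ᵐᵒᵖ :=
  lift (MulOpposite.op (g K n q ^ (n - 1))) (MulOpposite.op (-(x K n q * g K n q ^ (n - 1))))
    (by rw [← MulOpposite.op_pow, ← pow_mul, mul_comm, pow_mul, g_pow, one_pow,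
      MulOpposite.op_one])
    (by rw [← MulOpposite.op_pow, neg_pow, mul_pow_eq_zero_of_qCommute pred_pow_mul_x x_pow,
      mul_zero, MulOpposite.op_zero])
    (by
      rw [← MulOpposite.op_mul, ← MulOpposite.op_mul, ← MulOpposite.op_smul, mul_neg, neg_mul,
        ← mul_assoc, pred_pow_mul_x, smul_mul_assoc, smul_neg])

variable (K n q) in
/-- The antipode as a linear map. -/
def antipodeLin [NeZero n] : Taft K n q →ₗ[K] Taft K n q :=
  (MulOpposite.opLinearEquiv K).symm.toLinearMap ∘ₗ (antipodeHom K n q).toLinearMap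

section antipode

variable [NeZero n]

@[simp]
theorem antipodeLin_g : antipodeLin K n q (g K n q) = g K n q ^ (n - 1) := by
  simp [antipodeLin, antipodeHom]

@[simp]
theorem antipodeLin_x : antipodeLin K n q (x K n q) = -(x K n q * g K n q ^ (n - 1)) := by
  simp [antipodeLin, antipodeHom]

@[simp]
theorem antipodeLin_one : antipodeLin K n q 1 = 1 := by
  simp [antipodeLin]

theorem antipodeLin_mul (a b : Taft K n q) :
    antipodeLin K n q (a * b) = antipodeLin K n q b * antipodeLin K n q a := by
  simp [antipodeLin]

variable [Fact (IsPrimitiveRoot q n)]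

@[simp]
theorem comul_g : Coalgebra.comul (R := K) (g K n q) = g K n q ⊗ₜ g K n q :=
  lift_g _ _ _ _ _

@[simp]
theorem comul_x : Coalgebra.comul (R := K) (x K n q) = x K n q ⊗ₜ g K n q + 1 ⊗ₜ x K n q :=
  lift_x _ _ _ _ _

@[simp]
theorem counit_g : Coalgebra.counit (R := K) (g K n q) = 1 :=
  lift_g _ _ _ _ _

@[simp]
theorem counit_x : Coalgebra.counit (R := K) (x K n q) = 0 :=
  lift_x _ _ _ _ _

theorem mul_antipode_rTensor (t : Taft K n q) :
    LinearMap.mul' K _ ((antipodeLin K n q).rTensor _ (Coalgebra.comul (R := K) t)) =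
      algebraMap K _ (Coalgebra.counit (R := K) t) := by
  have key : ∀ (s : Taft K n q ⊗[K] Taft K n q) (a b : Taft K n q),
      LinearMap.mul' K _ ((antipodeLin K n q).rTensor _ (s * a ⊗ₜ b)) = antipodeLin K n q a *
        LinearMap.mul' K _ ((antipodeLin K n q).rTensor _ s) * b := by
    intro s a b
    induction s with
    | zero => simp
    | add s t hs ht => simp only [add_mul, mul_add, map_add, hs, ht]
    | tmul c d => simp [antipodeLin_mul, mul_assoc]
  induction t using induction with
  | hr r => simp [Algebra.TensorProduct.one_def, Algebra.algebraMap_eq_smul_one]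
  | hg => simp [pred_pow_mul]
  | hx => simp [mul_assoc, pred_pow_mul]
  | hadd a b ha hb => simp only [map_add, ha, hb]
  | hmul a b ha hb =>
    rw [Bialgebra.comul_mul, Bialgebra.counit_mul, map_mul (algebraMap K _), ← hb]
    generalize (Coalgebra.comul b : Taft K n q ⊗[K] Taft K n q) = s
    induction s with
    | zero => simp
    | add s t hs ht => simp only [mul_add, map_add, hs, ht]
    | tmul c d =>
      rw [key, ha, ← Algebra.commutes, mul_assoc]
      simp

theorem mul_antipode_lTensor (t : Taft K n q) :
    LinearMap.mul' K _ ((antipodeLin K n q).lTensor _ (Coalgebra.comul (R := K) t)) =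
      algebraMap K _ (Coalgebra.counit (R := K) t) := by
  have key : ∀ (s : Taft K n q ⊗[K] Taft K n q) (a b : Taft K n q),
      LinearMap.mul' K _ ((antipodeLin K n q).lTensor _ (a ⊗ₜ b * s)) =
        a * LinearMap.mul' K _ ((antipodeLin K n q).lTensor _ s) * antipodeLin K n q b := by
    intro s a b
    induction s with
    | zero => simp
    | add s t hs ht => simp only [add_mul, mul_add, map_add, hs, ht]
    | tmul c d => simp [antipodeLin_mul, mul_assoc]
  induction t using induction with
  | hr r => simp [Algebra.TensorProduct.one_def, Algebra.algebraMap_eq_smul_one]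
  | hg => simp [mul_pred_pow]
  | hx => simp
  | hadd a b ha hb => simp only [map_add, ha, hb]
  | hmul a b ha hb =>
    rw [Bialgebra.comul_mul, Bialgebra.counit_mul, mul_comm, map_mul (algebraMap K _), ← ha]
    generalize (Coalgebra.comul a : Taft K n q ⊗[K] Taft K n q) = s
    induction s with
    | zero => simp
    | add s t hs ht => simp only [add_mul, mul_add, map_add, hs, ht]
    | tmul c d =>
      rw [key, hb, ← Algebra.commutes, mul_assoc]
      simp

instance : HopfAlgebra K (Taft K n q) where
  antipode := antipodeLin K n q
  mul_antipode_rTensor_comul := LinearMap.ext mul_antipode_rTensor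
  mul_antipode_lTensor_comul := LinearMap.ext mul_antipode_lTensor

end antipode

instance [h : Fact (IsPrimitiveRoot q n)] : Fact (IsPrimitiveRoot q⁻¹ n) := ⟨h.out.inv⟩

/-- The character `g ↦ ζ`, `x ↦ 0` of the Taft algebra, for an `n`-th root of unity `ζ`. -/
def character [NeZero n] (ζ : K) (hζ : ζ ^ n = 1) : Taft K n q →ₐ[K] K :=
  lift ζ 0 hζ (zero_pow (NeZero.ne n)) (by simp)

end Taft

/-! ### The tensor product of two Taft algebras -/

section TaftTensor

variable (K : Type u) [Field K] (n : ℕ) (q : K)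

/-- The Hopf algebra `H_n(q) = A_n(q) ⊗ A_n(q⁻¹)`. -/
abbrev TaftTensor : Type u := Taft K n q ⊗[K] Taft K n q⁻¹

namespace TaftTensor

/-- `a = 1 ⊗ x₁`. -/
def a : TaftTensor K n q := 1 ⊗ₜ Taft.x K n q⁻¹

/-- `b = 1 ⊗ g₁`. -/
def b : TaftTensor K n q := 1 ⊗ₜ Taft.g K n q⁻¹

/-- `c = g ⊗ 1`. -/
def c : TaftTensor K n q := Taft.g K n q ⊗ₜ 1

/-- `d = x ⊗ 1`. -/
def d : TaftTensor K n q := Taft.x K n q ⊗ₜ 1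

variable [NeZero n] [hq : Fact (IsPrimitiveRoot q n)]

/-- The character `b ↦ q^i`, `c ↦ q^j`, `a, d ↦ 0`. -/
def character (i j : ℕ) : TaftTensor K n q →ₐ[K] K :=
  Algebra.TensorProduct.lift
    (Taft.character (q ^ j) (by rw [← pow_mul, mul_comm, pow_mul, hq.out.pow_eq_one, one_pow]))
    (Taft.character (q ^ i) (by rw [← pow_mul, mul_comm, pow_mul, hq.out.pow_eq_one, one_pow]))
    (fun _ _ => Commute.all _ _)

/-- The one-dimensional module `S_{i,j}`, on which `b` acts by `q^i`, `c` acts by `q^j` and `a`, `d`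
act by zero. It depends only on the residues of `i` and `j` modulo `n`. -/
def S (i j : ℕ) : FDMod K (TaftTensor K n q) := FDMod.ofCharacter (character K n q i j)

theorem b_smul (i j : ℕ) (v : S K n q i j) : b K n q • v = q ^ i • v := by
  change character K n q i j (b K n q) • v = q ^ i • v
  simp [character, b, Taft.character]

theorem c_smul (i j : ℕ) (v : S K n q i j) : c K n q • v = q ^ j • v := by
  change character K n q i j (c K n q) • v = q ^ j • v
  simp [character, c, Taft.character]

theorem a_smul (i j : ℕ) (v : S K n q i j) : a K n q • v = 0 := by
  change character K n q i j (a K n q) • v = 0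
  simp [character, a, Taft.character]

theorem d_smul (i j : ℕ) (v : S K n q i j) : d K n q • v = 0 := by
  change character K n q i j (d K n q) • v = 0
  simp [character, d, Taft.character]

end TaftTensor

end TaftTensor

/-- The ideal `(x^n - 1, y^n - 1, z^2 - ∑_{0 ≤ i, j ≤ n - 1} x^i y^j z)` of `ℤ[x, y, z]`, where
`x`, `y`, `z` are the variables `X 0`, `X 1`, `X 2`. -/
def presentationIdeal (n : ℕ) : Ideal (MvPolynomial (Fin 3) ℤ) :=
  Ideal.span {MvPolynomial.X 0 ^ n - 1, MvPolynomial.X 1 ^ n - 1,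
    MvPolynomial.X 2 ^ 2 - ∑ i ∈ Finset.range n, ∑ j ∈ Finset.range n,
      MvPolynomial.X 0 ^ i * MvPolynomial.X 1 ^ j * MvPolynomial.X 2}

end

/-! The argument rests on weights, that is, pairs of eigenvalues of the commuting elements `b` and
`c`. A primitive `n`-th root of unity exists, so `n` is invertible in `K`, and the averaging
projectors `eigenProjector` lift weight vectors along every surjection.

The elements `a` and `d` are nilpotent and commute with the generators up to scalars, so they vanish
on simple modules, and the simple modules are the `S i j`. The module `P i j`, with basis `d ^ s a ^
t v`, is freely generated by a vector `v` of weight `(i, j)`. Thus homomorphisms out of it are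
weight vectors of the target, which makes it projective. Its weight space for `(i, j)` is the line
through `v`, which makes it the projective cover of `S i j`. A nonzero finite-dimensional projective
module maps onto some `S i j`, hence onto `P i j`, and splits. By induction on the dimension its
class is a sum of classes `[P i j]`.

If `V` has a basis of weight vectors, then `V ⊗ P i j` is the direct sum of the `P k l` over the
weights of `V` shifted by `(i, j)` (`greenClass_mul_P`). For `V = S i j` this gives `[P i j] = x ^ i
y ^ j z`. For `V = P 0 0`, whose weights run once through all pairs modulo `n`, it gives the
relation for `z ^ 2`. So the presented ring maps onto the projective class ring.

For injectivity, the `2 n ^ 2` monomials `x ^ i y ^ j` and `x ^ i y ^ j z` span the presented ring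
and go to `[S i j]` and `[P i j]`. These classes are linearly independent because additive
invariants separate them: the dimensions of `h M_{k,l}`, where `M_{k,l}` is a weight space of `M`,
for `h = 1` and `h = d ^ (n - 1) a ^ (n - 1)` (`eq_zero_of_sum_greenClass_eq_zero`). -/

noncomputable section

/-! ### Additive invariants and sums in the Green ring -/

section GreenRingLemmas

variable {K H : Type u} [Field K] [Ring H] [Bialgebra K H]

theorem greenClass_congr {M N : FDMod K H} (e : M ≃ₗ[H] N) : greenClass M = greenClass N := by
  unfold greenClass
  congr 2
  exact Quotient.sound ⟨e⟩

/-- A zero module satisfies `M ⊕ M ≅ M`, hence `[M] + [M] = [M]`. -/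
theorem greenClass_of_subsingleton (M : FDMod K H) [Subsingleton M] : greenClass M = 0 := by
  have h : greenClass (M.directSum M) = greenClass M :=
    greenClass_congr (M := M.directSum M) (N := M)
      { toFun := fun m => m.1
        invFun := fun m => (m, m)
        map_add' := fun _ _ => rfl
        map_smul' := fun _ _ => rfl
        left_inv := fun m => Prod.ext rfl (Subsingleton.elim _ _)
        right_inv := fun _ => rfl }
  rwa [greenClass_add, add_eq_left] at h

/-- An isomorphism invariant of modules as a function of isomorphism classes. -/
def IsoClass.lift {α : Type*} (f : FDMod K H → α)
    (hf : ∀ M N : FDMod K H, (M ≃ₗ[H] N) → f M = f N) (c : IsoClass K H) : α :=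
  Quotient.lift (s := FDMod.isoSetoid K H) f (fun M N ⟨e⟩ => hf M N e) c

/-- An additive isomorphism invariant of modules induces a homomorphism on the Green ring. -/
def greenLift (f : FDMod K H → ℤ) (hf : ∀ M N : FDMod K H, (M ≃ₗ[H] N) → f M = f N)
    (hadd : ∀ M N : FDMod K H, f (M.directSum N) = f M + f N) : GreenRing K H →+ ℤ :=
  QuotientAddGroup.lift (greenIdeal K H).toAddSubgroup
    (FreeAbelianGroup.lift (IsoClass.lift f hf)) (by
      -- The additive group of `greenIdeal` is by definition this closure, so it suffices to kill
      -- the generating relations.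
      change AddSubgroup.closure (greenRelations K H) ≤ _
      rw [AddSubgroup.closure_le]
      rintro _ ⟨M, N, rfl⟩
      simp only [SetLike.mem_coe, AddMonoidHom.mem_ker, map_sub, FreeAbelianGroup.lift_apply_of]
      change f (M.directSum N) - f M - f N = 0
      rw [hadd]; ring)

theorem greenLift_greenClass (f : FDMod K H → ℤ) (hf) (hadd) (M : FDMod K H) :
    greenLift f hf hadd (greenClass M) = f M :=
  FreeAbelianGroup.lift_apply_of _ _

namespace FDMod

/-- The direct sum of a finite family of modules. -/
def pi {ι : Type} [Finite ι] (N : ι → FDMod K H) : FDMod K H where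
  carrier := ∀ i, N i

/-- A submodule of a finite-dimensional module. -/
def ofSubmodule {M : FDMod K H} (N : Submodule H M) : FDMod K H where
  carrier := N
  finite := inferInstanceAs (Module.Finite K (N.restrictScalars K))

/-- A quotient of a finite-dimensional module. -/
def ofQuotient {M : FDMod K H} (N : Submodule H M) : FDMod K H where
  carrier := M ⧸ N
  finite := Module.Finite.of_surjective (N.mkQ.restrictScalars K) N.mkQ_surjective

end FDMod

/-- The defining relations speak only of binary sums, so indices are added one at a time. -/
theorem greenClass_pi {ι : Type} [Fintype ι] (N : ι → FDMod K H) :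
    greenClass (FDMod.pi N) = ∑ i, greenClass (N i) := by
  revert N
  refine Fintype.induction_empty_option (P := fun ι _ => ∀ N : ι → FDMod K H,
    greenClass (FDMod.pi N) = ∑ i, greenClass (N i)) ?_ ?_ ?_ ι
  · intro α β _ e ih N
    let _ : Fintype α := Fintype.ofEquiv β e.symm
    rw [← e.sum_comp, ← ih fun i => N (e i)]
    exact (greenClass_congr (M := FDMod.pi fun i => N (e i)) (N := FDMod.pi N)
      (LinearEquiv.piCongrLeft H (fun i => (N i : Type u)) e)).symm
  · intro N
    rw [Finset.univ_eq_empty, Finset.sum_empty]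
    have : Subsingleton (FDMod.pi N) := inferInstanceAs (Subsingleton (∀ i, N i))
    exact greenClass_of_subsingleton _
  · intro α _ ih N
    rw [Fintype.sum_option, ← ih fun i => N (some i), ← greenClass_add]
    exact greenClass_congr (M := FDMod.pi N)
      (N := (N none).directSum (FDMod.pi fun i => N (some i)))
      (LinearEquiv.piOptionEquivProd H (M := fun i => (N i : Type u)))

/-- A surjection onto a projective module splits. -/
theorem exists_equiv_prod_ker_of_surjective {R M N : Type*} [Ring R] [AddCommGroup M] [Module R M]
    [AddCommGroup N] [Module R N] [Module.Projective R N] (f : M →ₗ[R] N)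
    (hf : Function.Surjective f) : Nonempty (M ≃ₗ[R] N × LinearMap.ker f) := by
  obtain ⟨g, hg⟩ := Module.projective_lifting_property f LinearMap.id hf
  have hg' : ∀ y, f (g y) = y := fun y => LinearMap.congr_fun hg y
  -- With a section `g` of `f`, each `m` is `g (f m)` plus an element of the kernel.
  exact ⟨{ toFun := fun m => (f m, ⟨m - g (f m), by simp [hg']⟩)
           invFun := fun p => g p.1 + p.2
           map_add' := fun a b => by ext <;> simp; abel
           map_smul' := fun r a => by ext <;> simp [smul_sub]
           left_inv := fun m => by simp
           right_inv := fun p => by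
             have : f p.2 = 0 := p.2.2
             ext <;> simp [hg', this] }⟩

theorem greenClass_eq_add_ker {M N : FDMod K H} [Module.Projective H N] (f : M →ₗ[H] N)
    (hf : Function.Surjective f) :
    greenClass M = greenClass N + greenClass (FDMod.ofSubmodule (LinearMap.ker f)) := by
  obtain ⟨e⟩ := exists_equiv_prod_ker_of_surjective f hf
  rw [← greenClass_add]
  exact greenClass_congr (N := N.directSum (FDMod.ofSubmodule (LinearMap.ker f))) e

/-- A surjective homomorphism between modules of the same dimension is an isomorphism. -/
theorem greenClass_eq_of_surjective {M N : FDMod K H} (f : M →ₗ[H] N) (hf : Function.Surjective f)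
    (hd : Module.finrank K M = Module.finrank K N) : greenClass M = greenClass N := by
  have hi : Function.Injective f :=
    (LinearMap.injective_iff_surjective_of_finrank_eq_finrank
      (f := f.restrictScalars K) hd).mpr hf
  exact greenClass_congr (LinearEquiv.ofBijective f ⟨hi, hf⟩)

/-- Lift `τ` through `π` to `f`. Since `π ∘ f = τ` is onto, the range of `f` and the kernel of `π`
together span `P`, and the kernel is superfluous. -/
theorem IsProjectiveCover.exists_surjective {R P Q M : Type*} [Ring R] [AddCommGroup P]
    [Module R P] [AddCommGroup Q] [Module R Q] [AddCommGroup M] [Module R M]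
    [Module.Projective R Q] {π : P →ₗ[R] M} (hπ : IsProjectiveCover π) (τ : Q →ₗ[R] M)
    (hτ : Function.Surjective τ) : ∃ f : Q →ₗ[R] P, Function.Surjective f := by
  obtain ⟨f, hf⟩ := Module.projective_lifting_property π τ hπ.surjective
  refine ⟨f, LinearMap.range_eq_top.mp (hπ.superfluous _ (eq_top_iff.mpr fun p _ => ?_))⟩
  obtain ⟨y, hy⟩ := hτ (π p)
  have hfy : π (f y) = π p := by rw [← hy, ← hf]; rfl
  rw [← add_sub_cancel (f y) p]
  exact add_mem (Submodule.mem_sup_left ⟨y, rfl⟩) (Submodule.mem_sup_right (by simp [hfy]))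

/-- Finite-dimensional projective covers of the same module have the same class. -/
theorem IsProjectiveCover.greenClass_eq {P Q : FDMod K H} {M : Type*} [AddCommGroup M] [Module H M]
    {π : P →ₗ[H] M} {τ : Q →ₗ[H] M} (hπ : IsProjectiveCover π) (hτ : IsProjectiveCover τ) :
    greenClass P = greenClass Q := by
  have := hπ.projective
  have := hτ.projective
  obtain ⟨f, hf⟩ := hπ.exists_surjective τ hτ.surjective
  obtain ⟨g, hg⟩ := hτ.exists_surjective π hπ.surjective
  -- Surjections in both directions force equal dimensions, so each of them is bijective.
  exact greenClass_eq_of_surjective g hg (le_antisymm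
    (LinearMap.finrank_le_finrank_of_surjective (f := f.restrictScalars K) hf)
    (LinearMap.finrank_le_finrank_of_surjective (f := g.restrictScalars K) hg))

end GreenRingLemmas

/-! ### Generators of the tensor product of two Taft algebras -/

namespace TaftTensor

section relations

variable {K : Type u} [Field K] {n : ℕ} {q : K}

theorem a_pow : a K n q ^ n = 0 := by
  rw [a, Algebra.TensorProduct.tmul_pow, Taft.x_pow, TensorProduct.tmul_zero]

theorem d_pow : d K n q ^ n = 0 := by
  rw [d, Algebra.TensorProduct.tmul_pow, Taft.x_pow, TensorProduct.zero_tmul]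

theorem b_pow : b K n q ^ n = 1 := by
  rw [b, Algebra.TensorProduct.tmul_pow, Taft.g_pow, one_pow, Algebra.TensorProduct.one_def]

theorem c_pow : c K n q ^ n = 1 := by
  rw [c, Algebra.TensorProduct.tmul_pow, Taft.g_pow, one_pow, Algebra.TensorProduct.one_def]

theorem a_mul_b : a K n q * b K n q = q⁻¹ • (b K n q * a K n q) := by
  rw [a, b, Algebra.TensorProduct.tmul_mul_tmul, Algebra.TensorProduct.tmul_mul_tmul,
    Taft.x_mul_g, TensorProduct.tmul_smul]

theorem d_mul_c : d K n q * c K n q = q • (c K n q * d K n q) := by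
  rw [d, c, Algebra.TensorProduct.tmul_mul_tmul, Algebra.TensorProduct.tmul_mul_tmul,
    Taft.x_mul_g, TensorProduct.smul_tmul']

theorem commute_tmul_one (s : Taft K n q) (t : Taft K n q⁻¹) :
    Commute (s ⊗ₜ[K] (1 : Taft K n q⁻¹)) ((1 : Taft K n q) ⊗ₜ[K] t) := by
  simp [commute_iff_eq]

theorem commute_c_a : Commute (c K n q) (a K n q) := commute_tmul_one _ _

theorem commute_c_b : Commute (c K n q) (b K n q) := commute_tmul_one _ _

theorem commute_d_a : Commute (d K n q) (a K n q) := commute_tmul_one _ _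

theorem commute_d_b : Commute (d K n q) (b K n q) := commute_tmul_one _ _

/-- Four generators suffice because `s ⊗ t = (s ⊗ 1) (1 ⊗ t)`. -/
theorem induction {p : TaftTensor K n q → Prop} (hr : ∀ r : K, p (algebraMap K _ r))
    (ha : p (a K n q)) (hb : p (b K n q)) (hc : p (c K n q)) (hd : p (d K n q))
    (hadd : ∀ s t, p s → p t → p (s + t)) (hmul : ∀ s t, p s → p t → p (s * t))
    (h : TaftTensor K n q) : p h := by
  have h1 : ∀ s : Taft K n q, p (s ⊗ₜ 1) := by
    intro s
    induction s using Taft.induction with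
    | hr r => exact hr r
    | hg => exact hc
    | hx => exact hd
    | hadd s t hs ht => rw [TensorProduct.add_tmul]; exact hadd _ _ hs ht
    | hmul s t hs ht =>
      rw [← one_mul (1 : Taft K n q⁻¹), ← Algebra.TensorProduct.tmul_mul_tmul]
      exact hmul _ _ hs ht
  have h2 : ∀ s : Taft K n q⁻¹, p (1 ⊗ₜ s) := by
    intro s
    induction s using Taft.induction with
    | hr r => rw [← Algebra.TensorProduct.algebraMap_apply']; exact hr r
    | hg => exact hb
    | hx => exact ha
    | hadd s t hs ht => rw [TensorProduct.tmul_add]; exact hadd _ _ hs ht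
    | hmul s t hs ht =>
      rw [← one_mul (1 : Taft K n q), ← Algebra.TensorProduct.tmul_mul_tmul]
      exact hmul _ _ hs ht
  induction h using TensorProduct.induction_on with
  | zero => simpa using hr 0
  | add s t hs ht => exact hadd _ _ hs ht
  | tmul s t =>
    rw [← mul_one s, ← one_mul t, ← Algebra.TensorProduct.tmul_mul_tmul]
    exact hmul _ _ (h1 s) (h2 t)

/-- A linear map that commutes with the generators is a homomorphism of modules. -/
def linearMapOfGenerators {M N : Type*} [AddCommGroup M] [Module K M] [Module (TaftTensor K n q) M]
    [IsScalarTower K (TaftTensor K n q) M] [AddCommGroup N] [Module K N]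
    [Module (TaftTensor K n q) N] [IsScalarTower K (TaftTensor K n q) N] (f : M →ₗ[K] N)
    (ha : ∀ m, f (a K n q • m) = a K n q • f m) (hb : ∀ m, f (b K n q • m) = b K n q • f m)
    (hc : ∀ m, f (c K n q • m) = c K n q • f m) (hd : ∀ m, f (d K n q • m) = d K n q • f m) :
    M →ₗ[TaftTensor K n q] N :=
  { f with
    map_smul' := fun h => by
      change ∀ m, f (h • m) = h • f m
      induction h using induction with
      | hr r => intro m; rw [algebraMap_smul, algebraMap_smul, map_smul]
      | ha => exact ha
      | hb => exact hb
      | hc => exact hc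
      | hd => exact hd
      | hadd s t hs ht => intro m; rw [add_smul, add_smul, map_add, hs, ht]
      | hmul s t hs ht => intro m; rw [mul_smul, mul_smul, hs, ht] }

@[simp]
theorem linearMapOfGenerators_apply {M N : Type*} [AddCommGroup M] [Module K M]
    [Module (TaftTensor K n q) M]
    [IsScalarTower K (TaftTensor K n q) M] [AddCommGroup N] [Module K N]
    [Module (TaftTensor K n q) N] [IsScalarTower K (TaftTensor K n q) N] (f : M →ₗ[K] N)
    (ha hb hc hd) (m : M) :
    linearMapOfGenerators (q := q) (n := n) f ha hb hc hd m = f m := rfl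

/-- A subspace that is stable under the generators is a submodule. -/
def submoduleOfGenerators {M : Type*} [AddCommGroup M] [Module K M] [Module (TaftTensor K n q) M]
    [IsScalarTower K (TaftTensor K n q) M] (N : Submodule K M)
    (ha : ∀ m ∈ N, a K n q • m ∈ N) (hb : ∀ m ∈ N, b K n q • m ∈ N)
    (hc : ∀ m ∈ N, c K n q • m ∈ N) (hd : ∀ m ∈ N, d K n q • m ∈ N) :
    Submodule (TaftTensor K n q) M :=
  { N with
    smul_mem' := fun h => by
      change ∀ {m}, m ∈ N → h • m ∈ N
      induction h using induction with
      | hr r => intro m hm; rw [algebraMap_smul]; exact N.smul_mem r hm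
      | ha => exact ha _
      | hb => exact hb _
      | hc => exact hc _
      | hd => exact hd _
      | hadd s t hs ht => intro m hm; rw [add_smul]; exact add_mem (hs hm) (ht hm)
      | hmul s t hs ht => intro m hm; rw [mul_smul]; exact hs (ht hm) }

end relations

/-! ### Comultiplication of the generators and their action on tensor products -/

section comul

variable {K : Type u} [Field K] {n : ℕ} {q : K} [NeZero n] [Fact (IsPrimitiveRoot q n)]

theorem comul_a : Coalgebra.comul (R := K) (a K n q) =
    a K n q ⊗ₜ b K n q + 1 ⊗ₜ a K n q := by
  simp [a, b, TensorProduct.comul_tmul, Bialgebra.comul_one, Algebra.TensorProduct.one_def,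
    TensorProduct.tmul_add]

theorem comul_b : Coalgebra.comul (R := K) (b K n q) = b K n q ⊗ₜ b K n q := by
  simp [b, TensorProduct.comul_tmul, Bialgebra.comul_one, Algebra.TensorProduct.one_def]

theorem comul_c : Coalgebra.comul (R := K) (c K n q) = c K n q ⊗ₜ c K n q := by
  simp [c, TensorProduct.comul_tmul, Bialgebra.comul_one, Algebra.TensorProduct.one_def]

theorem comul_d : Coalgebra.comul (R := K) (d K n q) =
    d K n q ⊗ₜ c K n q + 1 ⊗ₜ d K n q := by
  simp [c, d, TensorProduct.comul_tmul, Bialgebra.comul_one, Algebra.TensorProduct.one_def,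
    TensorProduct.add_tmul]

variable (M N : FDMod K (TaftTensor K n q))

/-- The pure tensor `m ⊗ w` as an element of the module `M ⊗ N`. -/
def tmul {M N : FDMod K (TaftTensor K n q)} (m : M) (w : N) : M.tensor N := m ⊗ₜ[K] w

variable {M N}

theorem tensor_smul_eq (h : TaftTensor K n q) (m : M) (w : N) :
    h • tmul m w = FDMod.tensorAction M.rep N.rep (Coalgebra.comul h) (m ⊗ₜ[K] w) := rfl

theorem a_smul_tmul (m : M) (w : N) :
    a K n q • tmul m w = tmul (a K n q • m) (b K n q • w) + tmul m (a K n q • w) := by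
  rw [tensor_smul_eq, comul_a, map_add, LinearMap.add_apply, FDMod.tensorAction_tmul_tmul,
    FDMod.tensorAction_tmul_tmul, map_one]
  rfl

theorem b_smul_tmul (m : M) (w : N) :
    b K n q • tmul m w = tmul (b K n q • m) (b K n q • w) := by
  rw [tensor_smul_eq, comul_b, FDMod.tensorAction_tmul_tmul]
  rfl

theorem c_smul_tmul (m : M) (w : N) :
    c K n q • tmul m w = tmul (c K n q • m) (c K n q • w) := by
  rw [tensor_smul_eq, comul_c, FDMod.tensorAction_tmul_tmul]
  rfl

theorem d_smul_tmul (m : M) (w : N) :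
    d K n q • tmul m w = tmul (d K n q • m) (c K n q • w) + tmul m (d K n q • w) := by
  rw [tensor_smul_eq, comul_d, map_add, LinearMap.add_apply, FDMod.tensorAction_tmul_tmul,
    FDMod.tensorAction_tmul_tmul, map_one]
  rfl

theorem smul_tmul (r : K) (m : M) (w : N) : tmul (r • m) w = r • tmul m w :=
  TensorProduct.smul_tmul' r m w

theorem tmul_smul (r : K) (m : M) (w : N) : tmul m (r • w) = r • tmul m w :=
  TensorProduct.tmul_smul r m w

theorem zero_tmul (w : N) : tmul (0 : M) w = 0 := TensorProduct.zero_tmul _ w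

theorem tmul_zero (m : M) : tmul m (0 : N) = 0 := TensorProduct.tmul_zero _ m

theorem add_tmul (m m' : M) (w : N) : tmul (m + m') w = tmul m w + tmul m' w :=
  TensorProduct.add_tmul m m' w

theorem tmul_add (m : M) (w w' : N) : tmul m (w + w') = tmul m w + tmul m w' :=
  TensorProduct.tmul_add m w w'

end comul

end TaftTensor

/-! ### Weight spaces and simple modules -/

/-- The projector onto the `z`-eigenspace of an element `t` with `t ^ n = 1`. -/
def eigenProjector {K A : Type*} [Field K] [Ring A] [Algebra K A] (n : ℕ) (t : A) (z : K) : A :=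
  (n : K)⁻¹ • ∑ k ∈ Finset.range n, (z⁻¹ • t) ^ k

section eigenProjector

variable {K A : Type*} [Field K] [Ring A] [Algebra K A] {n : ℕ} {t : A} {z : K}

/-- The geometric sum is fixed by `z⁻¹ t`, since `(z⁻¹ t - 1)` times it telescopes to `(z⁻¹ t) ^ n -
1 = 0`. -/
theorem mul_eigenProjector [NeZero n] (ht : t ^ n = 1) (hz : z ^ n = 1) :
    t * eigenProjector n t z = z • eigenProjector n t z := by
  have hz0 : z ≠ 0 := by rintro rfl; simp [zero_pow (NeZero.ne n)] at hz
  have h := mul_geom_sum (z⁻¹ • t) n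
  rw [smul_pow, ht, inv_pow, hz, inv_one, one_smul, sub_self, sub_mul, one_mul, sub_eq_zero] at h
  rw [smul_mul_assoc, inv_smul_eq_iff₀ hz0] at h
  rw [eigenProjector, mul_smul_comm, smul_comm z, h]

theorem commute_eigenProjector {s : A} (h : Commute s t) :
    Commute s (eigenProjector n t z) := by
  refine Commute.smul_right (Commute.sum_right _ _ _ fun k _ => ?_) _
  exact (h.smul_right _).pow_right k

/-- Each of the `n` summands fixes `m`; the factor `n⁻¹` then requires `n ≠ 0` in `K`. -/
theorem eigenProjector_smul [NeZero (n : K)] {M : Type*} [AddCommGroup M] [Module K M] [Module A M]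
    [IsScalarTower K A M] {m : M} (hz : z ≠ 0) (hm : t • m = z • m) :
    eigenProjector n t z • m = m := by
  have h1 : (z⁻¹ • t) • m = m := by rw [smul_assoc, hm, smul_smul, inv_mul_cancel₀ hz, one_smul]
  have h2 : ∀ k : ℕ, (z⁻¹ • t) ^ k • m = m := fun k => by
    induction k with
    | zero => rw [pow_zero, one_smul]
    | succ k ih => rw [pow_succ, mul_smul, h1, ih]
  rw [eigenProjector, smul_assoc, Finset.sum_smul, Finset.sum_congr rfl fun k _ => h2 k,
    Finset.sum_const, Finset.card_range, ← Nat.cast_smul_eq_nsmul K, smul_smul,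
    inv_mul_cancel₀ (NeZero.ne _), one_smul]

end eigenProjector

namespace TaftTensor

variable {K : Type u} [Field K] {n : ℕ} {q : K}

section weightSpace

variable (n q) in
/-- The simultaneous eigenspace of `b` and `c` for the eigenvalues `q ^ i` and `q ^ j`. -/
def weightSpace (M : Type*) [AddCommGroup M] [Module K M] [Module (TaftTensor K n q) M]
    [IsScalarTower K (TaftTensor K n q) M] (i j : ℕ) : Submodule K M where
  carrier := {m | b K n q • m = q ^ i • m ∧ c K n q • m = q ^ j • m}
  add_mem' := fun ⟨h1, h2⟩ ⟨h3, h4⟩ => by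
    simp only [Set.mem_ofPred_eq, smul_add, h1, h2, h3, h4, and_self]
  zero_mem' := by simp
  smul_mem' := fun r m ⟨h1, h2⟩ => by
    simp only [Set.mem_ofPred_eq]
    rw [smul_comm _ r, h1, smul_comm _ r m, smul_comm _ r, h2, smul_comm _ r m]
    exact ⟨rfl, rfl⟩

variable {M N : Type*} [AddCommGroup M] [Module K M] [Module (TaftTensor K n q) M]
  [IsScalarTower K (TaftTensor K n q) M] [AddCommGroup N] [Module K N]
  [Module (TaftTensor K n q) N] [IsScalarTower K (TaftTensor K n q) N]

theorem mem_weightSpace {i j : ℕ} {m : M} :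
    m ∈ weightSpace n q M i j ↔ b K n q • m = q ^ i • m ∧ c K n q • m = q ^ j • m := Iff.rfl

theorem map_mem_weightSpace (f : M →ₗ[TaftTensor K n q] N) {i j : ℕ} {m : M}
    (hm : m ∈ weightSpace n q M i j) : f m ∈ weightSpace n q N i j := by
  rw [mem_weightSpace, ← f.map_smul, ← f.map_smul, hm.1, hm.2]
  exact ⟨(f.restrictScalars K).map_smul _ _, (f.restrictScalars K).map_smul _ _⟩

/-- Weight vectors lift along surjections. -/
theorem exists_mem_weightSpace_of_surjective [NeZero n] [hq : Fact (IsPrimitiveRoot q n)]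
    (f : M →ₗ[TaftTensor K n q] N) (hf : Function.Surjective f) {i j : ℕ} {y : N}
    (hy : y ∈ weightSpace n q N i j) : ∃ m ∈ weightSpace n q M i j, f m = y := by
  -- A primitive `n`-th root of unity exists only if the characteristic of `K` does not divide `n`.
  have hn : NeZero (n : K) := hq.out.neZero'
  have hq1 : ∀ k : ℕ, (q ^ k) ^ n = 1 := fun k => by
    rw [← pow_mul, mul_comm, pow_mul, hq.out.pow_eq_one, one_pow]
  have hq0 : ∀ k : ℕ, q ^ k ≠ 0 := fun k => pow_ne_zero _ (hq.out.ne_zero (NeZero.ne n))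
  obtain ⟨m, rfl⟩ := hf y
  -- Project an arbitrary preimage. The projectors commute with `f` and fix the weight vector `f m`,
  -- so the image does not change.
  refine ⟨eigenProjector n (b K n q) (q ^ i) • eigenProjector n (c K n q) (q ^ j) • m,
    ⟨?_, ?_⟩, ?_⟩
  · rw [← mul_smul, mul_eigenProjector b_pow (hq1 i), smul_assoc]
  · rw [← mul_smul, (commute_eigenProjector commute_c_b).eq, mul_smul, ← mul_smul (c K n q),
      mul_eigenProjector c_pow (hq1 j), smul_assoc, smul_comm]
  · rw [map_smul, map_smul, eigenProjector_smul (hq0 j) hy.2, eigenProjector_smul (hq0 i) hy.1]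

end weightSpace

/-- An element that normalizes the generators up to scalars and is nilpotent acts as zero on
simple modules. -/
theorem smul_eq_zero_of_isSimpleModule {M : Type*} [AddCommGroup M] [Module K M]
    [Module (TaftTensor K n q) M] [IsScalarTower K (TaftTensor K n q) M]
    [IsSimpleModule (TaftTensor K n q) M] {h : TaftTensor K n q} {k : ℕ} (hk : h ^ k = 0)
    (ha : ∃ r : K, h * a K n q = r • (a K n q * h)) (hb : ∃ r : K, h * b K n q = r • (b K n q * h))
    (hc : ∃ r : K, h * c K n q = r • (c K n q * h)) (hd : ∃ r : K, h * d K n q = r • (d K n q * h))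
    (m : M) : h • m = 0 := by
  have key : ∀ t : TaftTensor K n q, (∃ r : K, h * t = r • (t * h)) →
      ∀ m ∈ LinearMap.ker (Algebra.lsmul K K M h), t • m ∈ LinearMap.ker (Algebra.lsmul K K M h) := by
    rintro t ⟨r, hr⟩ m hm
    change h • m = 0 at hm
    change h • t • m = 0
    rw [← mul_smul, hr, smul_assoc, mul_smul, hm, smul_zero, smul_zero]
  -- Commutation up to scalars makes the kernel of `h` a submodule, so simplicity leaves two cases.
  let N := submoduleOfGenerators (LinearMap.ker (Algebra.lsmul K K M h)) (key _ ha) (key _ hb)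
    (key _ hc) (key _ hd)
  rcases eq_bot_or_eq_top N with hN | hN
  -- Here `h` acts injectively, hence so does `h ^ k = 0`, and every vector is zero.
  · have hinj : ∀ m : M, h • m = 0 → m = 0 := fun m hm => by
      have : m ∈ N := hm
      rwa [hN] at this
    have hpow : ∀ (l : ℕ) (m : M), h ^ l • m = 0 → m = 0 := fun l => by
      induction l with
      | zero => intro m hm; rwa [pow_zero, one_smul] at hm
      | succ l ih =>
        intro m hm
        rw [pow_succ', mul_smul] at hm
        exact ih m (hinj _ hm)
    rw [hpow k m (by rw [hk, zero_smul]), smul_zero]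
  · have : m ∈ N := hN ▸ Submodule.mem_top
    exact this

/-! ### Classification of the simple modules and products of their classes -/

section simple

variable [NeZero n] [hq : Fact (IsPrimitiveRoot q n)]

theorem finrank_S (i j : ℕ) : Module.finrank K (S K n q i j) = 1 := Module.finrank_self K

instance isSimpleModule_S (i j : ℕ) : IsSimpleModule (TaftTensor K n q) (S K n q i j) :=
  { toIsSimpleOrder := is_simple_module_of_finrank_eq_one (K := K) (finrank_S i j) }

variable (n q) in
/-- The basis vector of `S i j`. -/
def unitS (i j : ℕ) : S K n q i j := (1 : K)

theorem unitS_ne_zero (i j : ℕ) : unitS n q i j ≠ 0 := one_ne_zero (α := K)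

theorem eq_smul_unitS {i j : ℕ} (v : S K n q i j) : ∃ r : K, v = r • unitS n q i j :=
  ⟨v, (mul_one (M := K) v).symm⟩

theorem unitS_mem_weightSpace (i j : ℕ) : unitS n q i j ∈ weightSpace n q (S K n q i j) i j :=
  ⟨b_smul K n q i j _, c_smul K n q i j _⟩

/-- The linear map from `S i j` that sends the basis vector to `m`. -/
def linearMapS {M : Type*} [AddCommGroup M] [Module K M] (i j : ℕ) (m : M) :
    S K n q i j →ₗ[K] M :=
  (LinearMap.toSpanSingleton K M m : K →ₗ[K] M)

theorem linearMapS_unitS {M : Type*} [AddCommGroup M] [Module K M] (i j : ℕ) (m : M) :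
    linearMapS i j m (unitS n q i j) = m :=
  one_smul K m

/-- The homomorphism from `S i j` determined by a weight vector that `a` and `d` annihilate. -/
def homS {M : Type*} [AddCommGroup M] [Module K M] [Module (TaftTensor K n q) M]
    [IsScalarTower K (TaftTensor K n q) M] {i j : ℕ} (m : M) (hm : m ∈ weightSpace n q M i j)
    (ha : a K n q • m = 0) (hd : d K n q • m = 0) : S K n q i j →ₗ[TaftTensor K n q] M :=
  linearMapOfGenerators (linearMapS i j m)
    (fun v => by
      obtain ⟨r, rfl⟩ := eq_smul_unitS v
      rw [a_smul, map_zero, map_smul, linearMapS_unitS, smul_comm, ha, smul_zero])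
    (fun v => by
      obtain ⟨r, rfl⟩ := eq_smul_unitS v
      rw [b_smul, map_smul, map_smul, linearMapS_unitS, smul_comm (b K n q), hm.1, smul_comm])
    (fun v => by
      obtain ⟨r, rfl⟩ := eq_smul_unitS v
      rw [c_smul, map_smul, map_smul, linearMapS_unitS, smul_comm (c K n q), hm.2, smul_comm])
    (fun v => by
      obtain ⟨r, rfl⟩ := eq_smul_unitS v
      rw [d_smul, map_zero, map_smul, linearMapS_unitS, smul_comm, hd, smul_zero])

/-- By Schur's lemma the nonzero homomorphism `homS` between simple modules is bijective. -/
theorem nonempty_equiv_S {M : Type*} [AddCommGroup M] [Module K M] [Module (TaftTensor K n q) M]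
    [IsScalarTower K (TaftTensor K n q) M] [IsSimpleModule (TaftTensor K n q) M]
    {i j : ℕ} {m : M} (h0 : m ≠ 0) (hm : m ∈ weightSpace n q M i j) (ha : a K n q • m = 0)
    (hd : d K n q • m = 0) : Nonempty (M ≃ₗ[TaftTensor K n q] S K n q i j) := by
  have h1 : homS m hm ha hd ≠ 0 := fun h => h0 (by
    have := LinearMap.congr_fun h (unitS n q i j)
    rwa [homS, linearMapOfGenerators_apply, linearMapS_unitS] at this)
  exact ⟨(LinearEquiv.ofBijective _ (LinearMap.bijective_of_ne_zero h1)).symm⟩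

theorem greenClass_eq_S {M : FDMod K (TaftTensor K n q)} [IsSimpleModule (TaftTensor K n q) M]
    {i j : ℕ} {m : M} (h0 : m ≠ 0) (hm : m ∈ weightSpace n q M i j)
    (ha : a K n q • m = 0) (hd : d K n q • m = 0) : greenClass M = greenClass (S K n q i j) := by
  obtain ⟨e⟩ := nonempty_equiv_S h0 hm ha hd
  exact greenClass_congr e

/-- The tensor product is one-dimensional, hence simple, and weights add because `b` and `c` are
grouplike. -/
theorem greenClass_S_mul_S (i j k l : ℕ) : greenClass (S K n q i j) * greenClass (S K n q k l) =
    greenClass (S K n q (i + k) (j + l)) := by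
  rw [greenClass_mul]
  have : IsSimpleModule (TaftTensor K n q) ((S K n q i j).tensor (S K n q k l)) :=
    { toIsSimpleOrder := is_simple_module_of_finrank_eq_one (K := K) (by
        change Module.finrank K (K ⊗[K] K) = 1
        simp) }
  refine greenClass_eq_S (m := tmul (unitS n q i j) (unitS n q k l)) ?_ ⟨?_, ?_⟩ ?_ ?_
  · change (1 : K) ⊗ₜ[K] (1 : K) ≠ 0
    intro h
    simpa using congrArg (TensorProduct.lid K K) h
  · rw [b_smul_tmul, b_smul, b_smul, smul_tmul, tmul_smul, smul_smul, pow_add]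
  · rw [c_smul_tmul, c_smul, c_smul, smul_tmul, tmul_smul, smul_smul, pow_add]
  · rw [a_smul_tmul, a_smul, a_smul, zero_tmul, tmul_zero, add_zero]
  · rw [d_smul_tmul, d_smul, d_smul, zero_tmul, tmul_zero, add_zero]

/-- Indices are natural numbers; this is how they get reduced modulo `n`. -/
theorem greenClass_S_congr {i j k l : ℕ} (hi : q ^ i = q ^ k) (hj : q ^ j = q ^ l) :
    greenClass (S K n q i j) = greenClass (S K n q k l) :=
  greenClass_eq_S (unitS_ne_zero i j)
    (mem_weightSpace.mpr ⟨hi ▸ b_smul K n q i j _, hj ▸ c_smul K n q i j _⟩)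
    (a_smul K n q i j _) (d_smul K n q i j _)

/-- The character of weight `(0, 0)` is the counit, and the unit of the Green ring is the class of
the trivial module. -/
theorem greenClass_S_zero : greenClass (S K n q 0 0) = 1 := by
  change _ = greenClass (FDMod.trivial K (TaftTensor K n q))
  have h : character K n q 0 0 = Bialgebra.counitAlgHom K (TaftTensor K n q) := by
    refine Algebra.TensorProduct.ext ?_ ?_
    · apply Taft.algHom_ext <;> simp [character, Taft.character]
    · apply Taft.algHom_ext <;> simp [character, Taft.character]
  rw [S, h, FDMod.trivial]

theorem greenClass_S (i j : ℕ) : greenClass (S K n q i j) =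
    greenClass (S K n q 1 0) ^ i * greenClass (S K n q 0 1) ^ j := by
  have h1 : ∀ i, greenClass (S K n q 1 0) ^ i = greenClass (S K n q i 0) := fun i => by
    induction i with
    | zero => rw [pow_zero, greenClass_S_zero]
    | succ i ih => rw [pow_succ, ih, greenClass_S_mul_S]
  have h2 : ∀ j, greenClass (S K n q 0 1) ^ j = greenClass (S K n q 0 j) := fun j => by
    induction j with
    | zero => rw [pow_zero, greenClass_S_zero]
    | succ j ih => rw [pow_succ, ih, greenClass_S_mul_S]
  rw [h1, h2, greenClass_S_mul_S, add_zero, zero_add]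

/-- Every simple module is one of the modules `S i j`. -/
theorem exists_equiv_S_of_isSimpleModule [IsAlgClosed K] (M : FDMod K (TaftTensor K n q))
    [IsSimpleModule (TaftTensor K n q) M] :
    ∃ i j : ℕ, Nonempty (M ≃ₗ[TaftTensor K n q] S K n q i j) := by
  have ha : ∀ m : M, a K n q • m = 0 := fun m => smul_eq_zero_of_isSimpleModule a_pow
    ⟨1, by simp⟩ ⟨_, a_mul_b⟩ ⟨1, by rw [one_smul, commute_c_a.eq]⟩
    ⟨1, by rw [one_smul, commute_d_a.eq]⟩ m
  have hd : ∀ m : M, d K n q • m = 0 := fun m => smul_eq_zero_of_isSimpleModule d_pow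
    ⟨1, by rw [one_smul, commute_d_a.eq]⟩ ⟨1, by rw [one_smul, commute_d_b.eq]⟩ ⟨_, d_mul_c⟩
    ⟨1, by simp⟩ m
  have : Nontrivial M := IsSimpleModule.nontrivial (TaftTensor K n q) M
  have hroot : ∀ (t : TaftTensor K n q) (z : K) (m : M), t ^ n = 1 → m ≠ 0 → t • m = z • m →
      z ^ n = 1 := by
    intro t z m ht hm h
    have hp : ∀ k : ℕ, t ^ k • m = z ^ k • m := fun k => by
      induction k with
      | zero => simp
      | succ k ih => rw [pow_succ, mul_smul, h, smul_comm, ih, smul_smul, pow_succ']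
    have := hp n
    rw [ht, one_smul] at this
    rw [← sub_eq_zero]
    refine (smul_eq_zero.mp (?_ : (z ^ n - 1) • m = 0)).resolve_right hm
    rw [sub_smul, ← this, one_smul, sub_self]
  obtain ⟨z, hz⟩ := Module.End.exists_eigenvalue (Algebra.lsmul K K M (b K n q))
  -- The eigenspace of `b` for `z` is a submodule, because `c` commutes with `b` while `a` and `d`
  -- act by zero. Being nonzero, it is all of `M`, so any eigenvector of `c` is a weight vector.
  have hzb : ∀ m : M, b K n q • m = z • m := by
    let E := LinearMap.ker (Algebra.lsmul K K M (b K n q) - z • 1)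
    have hE : ∀ m, m ∈ E ↔ b K n q • m = z • m := fun m => by
      simp [E, sub_eq_zero]
    let N := submoduleOfGenerators E (fun m _ => by rw [ha]; exact zero_mem _)
      (fun m hm => by rw [hE] at hm ⊢; rw [hm, smul_comm, hm])
      (fun m hm => by
        rw [hE] at hm ⊢
        rw [← mul_smul, ← commute_c_b.eq, mul_smul, hm, smul_comm])
      (fun m _ => by rw [hd]; exact zero_mem _)
    obtain ⟨v, hv, hv0⟩ := hz.exists_hasEigenvector
    have hvN : v ∈ N := (hE v).mpr (Module.End.mem_eigenspace_iff.mp hv)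
    have hN : N = ⊤ := (eq_bot_or_eq_top N).resolve_left fun h => hv0 (by rwa [h] at hvN)
    intro m
    exact (hE m).mp (show m ∈ N from hN ▸ Submodule.mem_top)
  obtain ⟨w, hw⟩ := Module.End.exists_eigenvalue (Algebra.lsmul K K M (c K n q))
  obtain ⟨v, hv, hv0⟩ := hw.exists_hasEigenvector
  have hvc : c K n q • v = w • v := Module.End.mem_eigenspace_iff.mp hv
  -- Eigenvalues of `b` and `c` are `n`-th roots of unity, hence powers of `q`.
  obtain ⟨i, -, rfl⟩ := hq.out.eq_pow_of_pow_eq_one (hroot _ _ _ b_pow hv0 (hzb v))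
  obtain ⟨j, -, rfl⟩ := hq.out.eq_pow_of_pow_eq_one (hroot _ _ _ c_pow hv0 hvc)
  exact ⟨i, j, nonempty_equiv_S hv0 ⟨hzb v, hvc⟩ (ha v) (hd v)⟩

end simple

end TaftTensor

/-! ### The indecomposable projective modules -/

namespace Taft

variable {K : Type u} [Field K] {n : ℕ}

variable (K n) in
/-- The `s`-th standard basis vector of `K ^ n`, which is zero for `s ≥ n`. -/
def stdVec (s : ℕ) : Fin n → K := if h : s < n then Pi.single ⟨s, h⟩ 1 else 0

theorem stdVec_val (s : Fin n) : stdVec K n s = Pi.basisFun K (Fin n) s := by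
  simp [stdVec, s.2]

theorem stdVec_of_le {s : ℕ} (h : n ≤ s) : stdVec K n s = 0 := by
  simp [stdVec, h.not_gt]

variable (K n) in
/-- The operator `e_s ↦ e_{s+1}`. -/
def shift : Module.End K (Fin n → K) :=
  (Pi.basisFun K (Fin n)).constr K fun s => stdVec K n (s + 1)

variable (n) in
/-- The operator `e_s ↦ w_s e_s`. -/
def diag (w : ℕ → K) : Module.End K (Fin n → K) :=
  (Pi.basisFun K (Fin n)).constr K fun s => w s • stdVec K n s

-- Out-of-range vectors are zero, so no separate case is needed at the end `s + 1 = n`; the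
-- nilpotence of the shift is built in.
@[simp]
theorem shift_stdVec (s : ℕ) : shift K n (stdVec K n s) = stdVec K n (s + 1) := by
  by_cases h : s < n
  · rw [stdVec_val ⟨s, h⟩, shift, Module.Basis.constr_basis]
  · rw [stdVec_of_le (not_lt.mp h), stdVec_of_le (by omega), map_zero]

@[simp]
theorem diag_stdVec (w : ℕ → K) (s : ℕ) : diag n w (stdVec K n s) = w s • stdVec K n s := by
  by_cases h : s < n
  · rw [stdVec_val ⟨s, h⟩, diag, Module.Basis.constr_basis, stdVec_val ⟨s, h⟩]
  · rw [stdVec_of_le (not_lt.mp h), map_zero, smul_zero]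

theorem linearMap_ext_stdVec {M : Type*} [AddCommGroup M] [Module K M] {f g : (Fin n → K) →ₗ[K] M}
    (h : ∀ s, f (stdVec K n s) = g (stdVec K n s)) : f = g :=
  (Pi.basisFun K (Fin n)).ext fun s => by rw [← stdVec_val, h]

/-- The Taft module with basis `e_0, …, e_{n-1}` where `g e_s = z q^{-s} e_s` and
`x e_s = e_{s+1}`. -/
def cyclicRep [NeZero n] (q : K) [hq : Fact (IsPrimitiveRoot q n)] (z : K) (hz : z ^ n = 1) :
    Taft K n q →ₐ[K] Module.End K (Fin n → K) :=
  lift (diag n fun s => z * q⁻¹ ^ s) (shift K n)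
    (linearMap_ext_stdVec fun s => by
      have : ∀ k : ℕ, (diag n (fun s => z * q⁻¹ ^ s) ^ k) (stdVec K n s) =
          (z * q⁻¹ ^ s) ^ k • stdVec K n s := fun k => by
        induction k with
        | zero => simp
        | succ k ih => rw [pow_succ', Module.End.mul_apply, ih, map_smul, diag_stdVec, smul_smul,
            pow_succ]
      rw [this, mul_pow, hz, ← pow_mul, mul_comm s, pow_mul, inv_pow, hq.out.pow_eq_one]
      simp)
    (linearMap_ext_stdVec fun s => by
      have : ∀ k : ℕ, (shift K n ^ k) (stdVec K n s) = stdVec K n (s + k) := fun k => by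
        induction k with
        | zero => simp
        | succ k ih => rw [pow_succ', Module.End.mul_apply, ih, shift_stdVec, add_assoc]
      rw [this, stdVec_of_le (by omega), LinearMap.zero_apply])
    -- The coefficients of `e_{s+1}` to compare are `z q^{-s}` for `x g` and `q · z q^{-(s+1)}` for
    -- `q g x`.
    (linearMap_ext_stdVec fun s => by
      have hq0 := hq.out.ne_zero (NeZero.ne n)
      simp only [Module.End.mul_apply, diag_stdVec, map_smul, shift_stdVec, LinearMap.smul_apply,
        smul_smul]
      congr 1
      rw [pow_succ]
      field_simp)

end Taft

theorem mul_pow_of_qCommute {K A : Type*} [CommRing K] [Ring A] [Algebra K A] {r : K} {u x : A}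
    (h : u * x = r • (x * u)) (k : ℕ) : u * x ^ k = r ^ k • (x ^ k * u) := by
  induction k with
  | zero => simp
  | succ k ih =>
    rw [pow_succ, ← mul_assoc, ih, smul_mul_assoc, mul_assoc, h, mul_smul_comm, smul_smul,
      ← pow_succ, ← mul_assoc]

theorem IsPrimitiveRoot.pow_pow_eq_one {K : Type*} [CommMonoid K] {n : ℕ} {q : K}
    (hq : IsPrimitiveRoot q n) (k : ℕ) : (q ^ k) ^ n = 1 := by
  rw [← pow_mul, mul_comm, pow_mul, hq.pow_eq_one, one_pow]

/-- Weights are indexed by natural numbers, so lowering an exponent by one is recorded as adding `n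
- 1`. -/
theorem IsPrimitiveRoot.inv_eq_pow_pred {K : Type*} [Field K] {n : ℕ} [NeZero n] {q : K}
    (hq : IsPrimitiveRoot q n) : q⁻¹ = q ^ (n - 1) := by
  refine inv_eq_of_mul_eq_one_right ?_
  rw [← pow_succ', Nat.sub_add_cancel NeZero.one_le, hq.pow_eq_one]

theorem IsPrimitiveRoot.pow_mul_inv_pow {K : Type*} [Field K] {n : ℕ} [NeZero n] {q : K}
    (hq : IsPrimitiveRoot q n) (j s : ℕ) : q ^ j * q⁻¹ ^ s = q ^ (j + (n - 1) * s) := by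
  rw [hq.inv_eq_pow_pred, pow_add, pow_mul]

namespace TaftTensor

variable {K : Type u} [Field K] {n : ℕ} {q : K} [NeZero n] [hq : Fact (IsPrimitiveRoot q n)]

variable (n q) in
/-- The projective cover of `S i j`, with basis `d ^ s a ^ t v` for `0 ≤ s, t < n`, where `v` has
weight `(i, j)`. -/
def P (i j : ℕ) : FDMod K (TaftTensor K n q) :=
  FDMod.ofRep ((Module.endTensorEndAlgHom (R := K) (S := K) (A := K)).comp
    -- The first factor carries `c` and `d`, hence the index `j`; the second carries `b` and `a`,
    -- hence `i`.
    (Algebra.TensorProduct.map (Taft.cyclicRep q (q ^ j) (hq.out.pow_pow_eq_one j))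
      (Taft.cyclicRep q⁻¹ (q ^ i) (hq.out.pow_pow_eq_one i))))

variable (n q) in
/-- The vector `d ^ s a ^ t v` of `P i j`, where `v` is the generator. -/
def vec (i j s t : ℕ) : P n q i j := Taft.stdVec K n s ⊗ₜ[K] Taft.stdVec K n t

variable (n q) in
/-- The basis `d ^ s a ^ t v` of `P i j`. -/
def basisP (i j : ℕ) : Module.Basis (Fin n × Fin n) K (P n q i j) :=
  (Pi.basisFun K (Fin n)).tensorProduct (Pi.basisFun K (Fin n))

variable {i j : ℕ}

theorem basisP_apply (x : Fin n × Fin n) : basisP n q i j x = vec n q i j x.1 x.2 := by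
  rw [vec, Taft.stdVec_val, Taft.stdVec_val]
  exact Module.Basis.tensorProduct_apply' _ _ x

theorem finrank_P : Module.finrank K (P n q i j) = n * n := by
  rw [Module.finrank_eq_card_basis (basisP n q i j)]
  simp

theorem vec_of_le_left {s t : ℕ} (h : n ≤ s) : vec n q i j s t = 0 := by
  rw [vec, Taft.stdVec_of_le h]
  exact TensorProduct.zero_tmul _ _

theorem vec_of_le_right {s t : ℕ} (h : n ≤ t) : vec n q i j s t = 0 := by
  rw [vec, Taft.stdVec_of_le h]
  exact TensorProduct.tmul_zero _ _

theorem tmul_smul_vec (x : Taft K n q) (y : Taft K n q⁻¹) (s t : ℕ) :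
    (x ⊗ₜ[K] y : TaftTensor K n q) • vec n q i j s t =
      (Taft.cyclicRep q (q ^ j) (hq.out.pow_pow_eq_one j) x (Taft.stdVec K n s) ⊗ₜ[K]
      Taft.cyclicRep q⁻¹ (q ^ i) (hq.out.pow_pow_eq_one i) y (Taft.stdVec K n t) :
      (Fin n → K) ⊗[K] (Fin n → K)) := rfl

theorem a_smul_vec (s t : ℕ) : a K n q • vec n q i j s t = vec n q i j s (t + 1) := by
  rw [a, tmul_smul_vec, map_one, Module.End.one_apply, Taft.cyclicRep, Taft.lift_x,
    Taft.shift_stdVec, vec]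

theorem d_smul_vec (s t : ℕ) : d K n q • vec n q i j s t = vec n q i j (s + 1) t := by
  rw [d, tmul_smul_vec, map_one, Module.End.one_apply, Taft.cyclicRep, Taft.lift_x,
    Taft.shift_stdVec, vec]

theorem b_smul_vec (s t : ℕ) :
    b K n q • vec n q i j s t = q ^ (i + t) • vec n q i j s t := by
  rw [b, tmul_smul_vec, map_one, Module.End.one_apply, Taft.cyclicRep, Taft.lift_g,
    Taft.diag_stdVec, inv_inv, ← pow_add, TensorProduct.tmul_smul]
  rfl

theorem c_smul_vec (s t : ℕ) :
    c K n q • vec n q i j s t = q ^ (j + (n - 1) * s) • vec n q i j s t := by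
  rw [c, tmul_smul_vec, map_one, Module.End.one_apply, Taft.cyclicRep, Taft.lift_g,
    Taft.diag_stdVec, hq.out.pow_mul_inv_pow, ← TensorProduct.smul_tmul']
  rfl

/-- The second Taft algebra has parameter `q⁻¹`, so `a` raises the `b`-exponent, whereas `d` lowers
the `c`-exponent. -/
theorem vec_mem_weightSpace (s t : ℕ) :
    vec n q i j s t ∈ weightSpace n q (P n q i j) (i + t) (j + (n - 1) * s) :=
  ⟨b_smul_vec s t, c_smul_vec s t⟩

theorem vec_zero_mem_weightSpace : vec n q i j 0 0 ∈ weightSpace n q (P n q i j) i j :=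
  vec_mem_weightSpace 0 0

theorem linearMap_ext_vec {M : Type*} [AddCommGroup M] [Module K M] {f g : P n q i j →ₗ[K] M}
    (h : ∀ s t, f (vec n q i j s t) = g (vec n q i j s t)) : f = g :=
  (basisP n q i j).ext fun x => by rw [basisP_apply, h]

theorem pow_smul_vec (k l s t : ℕ) :
    d K n q ^ k • a K n q ^ l • vec n q i j s t = vec n q i j (s + k) (t + l) := by
  have h1 : a K n q ^ l • vec n q i j s t = vec n q i j s (t + l) := by
    induction l with
    | zero => simp
    | succ l ih => rw [pow_succ', mul_smul, ih, a_smul_vec, add_assoc]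
  rw [h1]
  induction k with
  | zero => simp
  | succ k ih => rw [pow_succ', mul_smul, ih, d_smul_vec, add_assoc]

/-! ### Homomorphisms from `P i j` as weight vectors -/

section homP

variable {M : Type*} [AddCommGroup M] [Module K M] [Module (TaftTensor K n q) M]

/-- The linear map `d ^ s a ^ t v ↦ d ^ s a ^ t m`. -/
def linearMapP (i j : ℕ) (m : M) : P n q i j →ₗ[K] M :=
  (basisP n q i j).constr K fun x => d K n q ^ (x.1 : ℕ) • a K n q ^ (x.2 : ℕ) • m

/-- This holds for all `s` and `t`: out of range, the left side vanishes by the convention for `vec`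
and the right side by `a ^ n = d ^ n = 0`. -/
theorem linearMapP_vec (m : M) (s t : ℕ) :
    linearMapP i j m (vec n q i j s t) = d K n q ^ s • a K n q ^ t • m := by
  by_cases hs : s < n
  · by_cases ht : t < n
    · have := (basisP n q i j).constr_basis K
        (fun x => d K n q ^ (x.1 : ℕ) • a K n q ^ (x.2 : ℕ) • m) (⟨s, hs⟩, ⟨t, ht⟩)
      rwa [basisP_apply] at this
    · rw [vec_of_le_right (not_lt.mp ht), map_zero, pow_eq_zero_of_le (not_lt.mp ht) a_pow,
        zero_smul, smul_zero]
  · rw [vec_of_le_left (not_lt.mp hs), map_zero, pow_eq_zero_of_le (not_lt.mp hs) d_pow,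
      zero_smul]

variable [IsScalarTower K (TaftTensor K n q) M]

theorem map_smul_of_map_smul_vec (f : P n q i j →ₗ[K] M) (h : TaftTensor K n q)
    (hf : ∀ s t, f (h • vec n q i j s t) = h • f (vec n q i j s t)) (p : P n q i j) :
    f (h • p) = h • f p := by
  have : f ∘ₗ Algebra.lsmul K K (P n q i j) h = Algebra.lsmul K K M h ∘ₗ f :=
    linearMap_ext_vec hf
  exact LinearMap.congr_fun this p

/-- The homomorphism from `P i j` determined by a vector of weight `(i, j)`. -/
def homP (m : M) (hm : m ∈ weightSpace n q M i j) : P n q i j →ₗ[TaftTensor K n q] M :=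
  linearMapOfGenerators (linearMapP i j m)
    (map_smul_of_map_smul_vec _ _ fun s t => by
      rw [a_smul_vec, linearMapP_vec, linearMapP_vec, ← mul_smul (a K n q),
        ← (commute_d_a.pow_left s).eq, mul_smul, ← mul_smul (a K n q), ← pow_succ'])
    (map_smul_of_map_smul_vec _ _ fun s t => by
      have hq0 := hq.out.ne_zero (NeZero.ne n)
      have hba : b K n q * a K n q = q • (a K n q * b K n q) := by
        rw [a_mul_b, smul_smul, mul_inv_cancel₀ hq0, one_smul]
      rw [b_smul_vec, map_smul, linearMapP_vec, ← mul_smul (b K n q),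
        ← (commute_d_b.pow_left s).eq, mul_smul _ (b K n q), ← mul_smul (b K n q),
        mul_pow_of_qCommute hba, smul_assoc, mul_smul _ (b K n q), hm.1,
        smul_comm (a K n q ^ t) (q ^ i) m, smul_smul (q ^ t), smul_comm (d K n q ^ s) (_ : K),
        pow_add, mul_comm (q ^ i)])
    (map_smul_of_map_smul_vec _ _ fun s t => by
      have hq0 := hq.out.ne_zero (NeZero.ne n)
      have hcd : c K n q * d K n q = q⁻¹ • (d K n q * c K n q) := by
        rw [d_mul_c, smul_smul, inv_mul_cancel₀ hq0, one_smul]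
      rw [c_smul_vec, map_smul, linearMapP_vec, ← mul_smul (c K n q),
        mul_pow_of_qCommute hcd, smul_assoc, mul_smul _ (c K n q), ← mul_smul (c K n q),
        (commute_c_a.pow_right t).eq, mul_smul _ (c K n q), hm.2, smul_comm _ (q ^ j),
        smul_comm _ (q ^ j), smul_smul (q⁻¹ ^ s), mul_comm (q⁻¹ ^ s), hq.out.pow_mul_inv_pow])
    (map_smul_of_map_smul_vec _ _ fun s t => by
      rw [d_smul_vec, linearMapP_vec, linearMapP_vec, ← mul_smul (d K n q), ← pow_succ'])

theorem homP_vec (m : M) (hm : m ∈ weightSpace n q M i j) (s t : ℕ) :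
    homP m hm (vec n q i j s t) = d K n q ^ s • a K n q ^ t • m :=
  linearMapP_vec m s t

theorem homP_vec_zero (m : M) (hm : m ∈ weightSpace n q M i j) :
    homP m hm (vec n q i j 0 0) = m := by
  rw [homP_vec, pow_zero, pow_zero, one_smul, one_smul]

end homP

/-- The elements `d ^ s a ^ t` carry `vec 0 0` to every basis vector. -/
theorem eq_top_of_vec_mem {N : Submodule (TaftTensor K n q) (P n q i j)}
    (h : vec n q i j 0 0 ∈ N) : N = ⊤ := by
  have hvec : ∀ s t, vec n q i j s t ∈ N := fun s t => by
    have := N.smul_mem (d K n q ^ s) (N.smul_mem (a K n q ^ t) h)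
    rwa [pow_smul_vec, zero_add, zero_add] at this
  refine eq_top_iff.mpr fun p _ => ?_
  rw [← (basisP n q i j).sum_repr p]
  refine (N.restrictScalars K).sum_mem fun x _ => (N.restrictScalars K).smul_mem _ ?_
  rw [basisP_apply]
  exact hvec _ _

/-- The modules `P i j` are projective, since weight vectors lift along surjections. -/
instance projective_P : Module.Projective (TaftTensor K n q) (P n q i j) := by
  refine Module.Projective.of_lifting_property'' fun f hf => ?_
  obtain ⟨m, hm, hfm⟩ := exists_mem_weightSpace_of_surjective f hf
    (vec_zero_mem_weightSpace (i := i) (j := j))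
  refine ⟨homP m hm, LinearMap.ext fun p => ?_⟩
  -- The equalizer of two homomorphisms is a submodule, so agreement at the generator is enough.
  have h : LinearMap.eqLocus (f ∘ₗ homP m hm) LinearMap.id = ⊤ :=
    eq_top_of_vec_mem (by
      rw [LinearMap.mem_eqLocus, LinearMap.comp_apply, homP_vec_zero, hfm, LinearMap.id_apply])
  exact LinearMap.mem_eqLocus.mp (h ▸ Submodule.mem_top : p ∈ _)

theorem repr_b_smul (p : P n q i j) (x : Fin n × Fin n) :
    (basisP n q i j).repr (b K n q • p) x = q ^ (i + x.2) * (basisP n q i j).repr p x := by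
  classical
  have : (basisP n q i j).coord x ∘ₗ Algebra.lsmul K K (P n q i j) (b K n q) =
      q ^ (i + (x.2 : ℕ)) • (basisP n q i j).coord x := by
    refine (basisP n q i j).ext fun y => ?_
    have hb : Algebra.lsmul K K (P n q i j) (b K n q) (basisP n q i j y) =
        q ^ (i + (y.2 : ℕ)) • basisP n q i j y := by
      rw [basisP_apply]; exact b_smul_vec _ _
    rw [LinearMap.comp_apply, hb, map_smul, LinearMap.smul_apply]
    by_cases hxy : y = x
    · rw [hxy]
    · simp [Finsupp.single_apply, hxy]
  exact LinearMap.congr_fun this p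

theorem repr_c_smul (p : P n q i j) (x : Fin n × Fin n) :
    (basisP n q i j).repr (c K n q • p) x =
      q ^ (j + (n - 1) * x.1) * (basisP n q i j).repr p x := by
  classical
  have : (basisP n q i j).coord x ∘ₗ Algebra.lsmul K K (P n q i j) (c K n q) =
      q ^ (j + (n - 1) * (x.1 : ℕ)) • (basisP n q i j).coord x := by
    refine (basisP n q i j).ext fun y => ?_
    have hc : Algebra.lsmul K K (P n q i j) (c K n q) (basisP n q i j y) =
        q ^ (j + (n - 1) * (y.1 : ℕ)) • basisP n q i j y := by
      rw [basisP_apply]; exact c_smul_vec _ _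
    rw [LinearMap.comp_apply, hc, map_smul, LinearMap.smul_apply]
    by_cases hxy : y = x
    · rw [hxy]
    · simp [Finsupp.single_apply, hxy]
  exact LinearMap.congr_fun this p

/-- Both `b` and `c` are diagonal in the basis, so a nonzero coordinate forces the two eigenvalues
to match. -/
theorem repr_eq_zero_of_mem_weightSpace {k l : ℕ} {p : P n q i j}
    (hp : p ∈ weightSpace n q (P n q i j) k l) (x : Fin n × Fin n)
    (hx : ¬ (q ^ (i + (x.2 : ℕ)) = q ^ k ∧ q ^ (j + (n - 1) * (x.1 : ℕ)) = q ^ l)) :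
    (basisP n q i j).repr p x = 0 := by
  have h1 := repr_b_smul p x
  have h2 := repr_c_smul p x
  rw [hp.1, map_smul, Finsupp.smul_apply, smul_eq_mul] at h1
  rw [hp.2, map_smul, Finsupp.smul_apply, smul_eq_mul] at h2
  by_contra h0
  exact hx ⟨(mul_right_cancel₀ h0 h1).symm, (mul_right_cancel₀ h0 h2).symm⟩

/-- A basis vector with indices `s, t < n` has weight `(i, j)` only if `q ^ t = 1` and `q⁻¹ ^ s =
1`, that is, `s = t = 0`. -/
theorem eq_smul_vec_of_mem_weightSpace {p : P n q i j} (hp : p ∈ weightSpace n q (P n q i j) i j) :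
    p = (basisP n q i j).repr p (0, 0) • vec n q i j 0 0 := by
  have hq0 := hq.out.ne_zero (NeZero.ne n)
  conv_lhs => rw [← (basisP n q i j).sum_repr p]
  rw [Finset.sum_eq_single (0, 0)]
  · rw [basisP_apply]; simp
  · intro x _ hx
    rw [repr_eq_zero_of_mem_weightSpace hp x, zero_smul]
    rintro ⟨h1, h2⟩
    refine hx (Prod.ext (Fin.ext ?_) (Fin.ext ?_))
    · rw [pow_add, mul_eq_left₀ (pow_ne_zero _ hq0), pow_mul, ← hq.out.inv_eq_pow_pred] at h2
      simpa using Nat.eq_zero_of_dvd_of_lt (hq.out.inv.dvd_of_pow_eq_one _ h2) x.1.2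
    · rw [pow_add, mul_eq_left₀ (pow_ne_zero _ hq0)] at h1
      simpa using Nat.eq_zero_of_dvd_of_lt (hq.out.dvd_of_pow_eq_one _ h1) x.2.2
  · intro h; exact absurd (Finset.mem_univ _) h

variable (n q) in
/-- The projection from `P i j` to `S i j`. -/
def projP (i j : ℕ) : P n q i j →ₗ[TaftTensor K n q] S K n q i j :=
  homP (unitS n q i j) (unitS_mem_weightSpace i j)

/-- For superfluity: if `N` and the kernel span `P i j`, then `N` maps onto `S i j` and contains a
vector of weight `(i, j)` with nonzero image. Such a vector is a nonzero multiple of the generator,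
so `N` is everything. -/
theorem isProjectiveCover_projP : IsProjectiveCover (projP n q i j) where
  projective := inferInstance
  surjective := by
    refine LinearMap.surjective_of_ne_zero fun h => unitS_ne_zero (n := n) (q := q) i j ?_
    rw [← homP_vec_zero (unitS n q i j) (unitS_mem_weightSpace i j)]
    exact LinearMap.congr_fun h _
  superfluous := by
    intro N hN
    have hsurj : Function.Surjective (projP n q i j ∘ₗ N.subtype) := by
      refine LinearMap.surjective_of_ne_zero fun h => unitS_ne_zero (n := n) (q := q) i j ?_
      have hle : N ≤ LinearMap.ker (projP n q i j) := fun p hp =>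
        LinearMap.congr_fun h ⟨p, hp⟩
      rw [sup_eq_right.mpr hle] at hN
      rw [← homP_vec_zero (unitS n q i j) (unitS_mem_weightSpace i j)]
      exact LinearMap.mem_ker.mp (hN ▸ Submodule.mem_top :
        vec n q i j 0 0 ∈ LinearMap.ker (projP n q i j))
    obtain ⟨m, hm, hm1⟩ := exists_mem_weightSpace_of_surjective _ hsurj (unitS_mem_weightSpace i j)
    have hm' := eq_smul_vec_of_mem_weightSpace (map_mem_weightSpace N.subtype hm)
    refine eq_top_of_vec_mem (?_ : vec n q i j 0 0 ∈ N.restrictScalars K)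
    have hr : (basisP n q i j).repr (N.subtype m) (0, 0) ≠ 0 := fun h0 => by
      rw [h0, zero_smul] at hm'
      rw [LinearMap.comp_apply, hm', map_zero] at hm1
      exact unitS_ne_zero i j hm1.symm
    rw [← Submodule.smul_mem_iff _ hr, ← hm']
    exact m.2

end TaftTensor

/-! ### Products in the Green ring -/

/-- Since `y ^ (n - 1)` is inverse to `y`, this is the substitution `s ↦ -s` on residues modulo `n`.
-/
theorem sum_range_pow_pred_mul {R : Type*} [Ring R] {n : ℕ} {y : R} (hy : y ^ n = 1) :
    ∑ s ∈ Finset.range n, y ^ ((n - 1) * s) = ∑ s ∈ Finset.range n, y ^ s := by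
  obtain _ | n := n
  · simp
  -- With `n + 1` in the role of `n`, reversing the order of summation leads to `n (n - s) ≡ s + 1`
  -- modulo `n + 1`.
  have h1 : ∀ s ∈ Finset.range (n + 1), y ^ ((n + 1 - 1) * (n + 1 - 1 - s)) = y ^ (s + 1) := by
    intro s hs
    have hs' := Finset.mem_range.mp hs
    obtain ⟨k, rfl⟩ : ∃ k, n = s + k := ⟨n - s, by omega⟩
    obtain _ | k := k
    · simp [hy]
    · have : (s + (k + 1) + 1 - 1) * (s + (k + 1) + 1 - 1 - s) = (s + (k + 1) + 1) * k + (s + 1) := by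
        have h2 : s + (k + 1) + 1 - 1 - s = k + 1 := by omega
        rw [h2, Nat.add_sub_cancel]; ring
      rw [this, pow_add, pow_mul, hy, one_pow, one_mul]
  rw [← Finset.sum_range_reflect, Finset.sum_congr rfl h1, Finset.sum_range_succ, hy,
    Finset.sum_range_succ', pow_zero]

namespace TaftTensor

variable {K : Type u} [Field K] {n : ℕ} {q : K} [NeZero n] [hq : Fact (IsPrimitiveRoot q n)]

theorem tmul_mem_weightSpace {M N : FDMod K (TaftTensor K n q)} {i j k l : ℕ} {m : M} {w : N}
    (hm : m ∈ weightSpace n q M i j) (hw : w ∈ weightSpace n q N k l) :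
    tmul m w ∈ weightSpace n q (M.tensor N) (i + k) (j + l) := by
  constructor
  · rw [b_smul_tmul, hm.1, hw.1, smul_tmul, tmul_smul, smul_smul, pow_add]
  · rw [c_smul_tmul, hm.2, hw.2, smul_tmul, tmul_smul, smul_smul, pow_add]

theorem finrank_tensor (M N : FDMod K (TaftTensor K n q)) :
    Module.finrank K (M.tensor N) = Module.finrank K M * Module.finrank K N :=
  Module.finrank_tensorProduct (R := K) (S := K) (M := M) (M' := N)

theorem tensor_eq_top {M N : FDMod K (TaftTensor K n q)}
    {T : Submodule (TaftTensor K n q) (M.tensor N)} (h : ∀ m w, tmul m w ∈ T) : T = ⊤ := by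
  refine eq_top_iff.mpr fun p _ => ?_
  refine TensorProduct.induction_on (motive := fun p => (p : M.tensor N) ∈ T) p
    (zero_mem T) h fun _ _ hx hy => T.add_mem hx hy

/-- For a module `V` with a basis of weight vectors, `V ⊗ P i j` is the direct sum of the modules
`P k l` over the weights of this basis, shifted by `(i, j)`. -/
theorem greenClass_mul_P {V : FDMod K (TaftTensor K n q)} {ι : Type} [Fintype ι]
    (v : Module.Basis ι K V) (k l : ι → ℕ) (hv : ∀ x, v x ∈ weightSpace n q V (k x) (l x))
    (i j : ℕ) : greenClass V * greenClass (P n q i j) =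
      ∑ x, greenClass (P n q (k x + i) (l x + j)) := by
  rw [greenClass_mul, ← greenClass_pi]
  have hw : ∀ x, tmul (v x) (vec n q i j 0 0) ∈
      weightSpace n q (V.tensor (P n q i j)) (k x + i) (l x + j) := fun x =>
    tmul_mem_weightSpace (hv x) vec_zero_mem_weightSpace
  -- The vectors `v x ⊗ vec 0 0` are weight vectors and define `f`. It is bijective once it is onto,
  -- since both dimensions are `dim V · n ^ 2`.
  let f : (∀ x, P n q (k x + i) (l x + j)) →ₗ[TaftTensor K n q] V.tensor (P n q i j) :=
    ∑ x, homP _ (hw x) ∘ₗ LinearMap.proj x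
  have hgen : ∀ x, tmul (v x) (vec n q i j 0 0) ∈ LinearMap.range f := by
    classical
    intro x
    refine ⟨Pi.single x (vec n q _ _ 0 0), ?_⟩
    simp only [f, LinearMap.sum_apply, LinearMap.comp_apply, LinearMap.proj_apply]
    rw [Finset.sum_eq_single x]
    · rw [Pi.single_eq_same, homP_vec_zero]
    · intro y _ hy
      rw [Pi.single_eq_of_ne hy, map_zero]
    · intro h; exact absurd (Finset.mem_univ _) h
  let T : Submodule K (V.tensor (P n q i j)) := (LinearMap.range f).restrictScalars K
  have h00 : ∀ m : V, tmul m (vec n q i j 0 0) ∈ T := by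
    intro m
    have : (⊤ : Submodule K V) ≤
        T.comap ((TensorProduct.mk K V (P n q i j)).flip (vec n q i j 0 0)) := by
      rw [← v.span_eq, Submodule.span_le]
      rintro _ ⟨x, rfl⟩
      exact hgen x
    exact this (Submodule.mem_top : m ∈ ⊤)
  -- In `a (m ⊗ w) = a m ⊗ b w + m ⊗ a w` with `w` a basis vector, `b w` is a multiple of `w`, so
  -- the first term already lies in `T`. This is why the hypothesis ranges over all `m`.
  have ha : ∀ s t, (∀ m : V, tmul m (vec n q i j s t) ∈ T) →
      ∀ m : V, tmul m (vec n q i j s (t + 1)) ∈ T := by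
    intro s t h m
    have h1 := (LinearMap.range f).smul_mem (a K n q) (h m)
    rw [a_smul_tmul, b_smul_vec, tmul_smul, a_smul_vec] at h1
    exact (T.add_mem_iff_right (T.smul_mem _ (h _))).mp h1
  have hd : ∀ s t, (∀ m : V, tmul m (vec n q i j s t) ∈ T) →
      ∀ m : V, tmul m (vec n q i j (s + 1) t) ∈ T := by
    intro s t h m
    have h1 := (LinearMap.range f).smul_mem (d K n q) (h m)
    rw [d_smul_tmul, c_smul_vec, tmul_smul, d_smul_vec] at h1
    exact (T.add_mem_iff_right (T.smul_mem _ (h _))).mp h1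
  have hst : ∀ s t (m : V), tmul m (vec n q i j s t) ∈ T := by
    intro s t
    induction s with
    | zero =>
      induction t with
      | zero => exact h00
      | succ t ih => exact ha _ _ ih
    | succ s ih => exact hd _ _ ih
  have hsurj : Function.Surjective f := by
    refine LinearMap.range_eq_top.mp (tensor_eq_top fun m w => ?_)
    have : (⊤ : Submodule K (P n q i j)) ≤ T.comap (TensorProduct.mk K V (P n q i j) m) := by
      rw [← (basisP n q i j).span_eq, Submodule.span_le]
      rintro _ ⟨x, rfl⟩
      rw [basisP_apply]
      exact hst _ _ m
    exact this (Submodule.mem_top : w ∈ ⊤)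
  refine (greenClass_eq_of_surjective
    (M := FDMod.pi fun x => P n q (k x + i) (l x + j)) f hsurj ?_).symm
  rw [finrank_tensor, finrank_P, Module.finrank_eq_card_basis v]
  refine (Module.finrank_pi_fintype K).trans ?_
  simp [finrank_P]

variable (n q) in
/-- The basis of `S i j` that consists of the vector `unitS i j`. -/
def basisS (i j : ℕ) : Module.Basis Unit K (S K n q i j) := Module.Basis.singleton Unit K

theorem basisS_apply (i j : ℕ) (x : Unit) : basisS n q i j x = unitS n q i j :=
  Module.Basis.singleton_apply Unit K x

theorem greenClass_S_mul_P (i j k l : ℕ) : greenClass (S K n q i j) * greenClass (P n q k l) =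
    greenClass (P n q (i + k) (j + l)) := by
  have := greenClass_mul_P (basisS n q i j)
    (fun _ => i) (fun _ => j) (fun x => by
      rw [basisS_apply]
      exact unitS_mem_weightSpace i j) k l
  simpa using this

/-- The opposite order needs its own argument, as the Green ring is not known to be commutative.
Since `a` and `d` kill the right factor, they act on `P ⊗ S` through the left factor up to nonzero
scalars, so the tensor of the generators generates. -/
theorem greenClass_P_mul_S (i j k l : ℕ) : greenClass (P n q i j) * greenClass (S K n q k l) =
    greenClass (P n q (i + k) (j + l)) := by
  rw [greenClass_mul]
  have hq0 := hq.out.ne_zero (NeZero.ne n)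
  let f := homP _ (tmul_mem_weightSpace (vec_zero_mem_weightSpace (i := i) (j := j))
    (unitS_mem_weightSpace (n := n) (q := q) k l))
  let T : Submodule K ((P n q i j).tensor (S K n q k l)) := (LinearMap.range f).restrictScalars K
  have h00 : tmul (vec n q i j 0 0) (unitS n q k l) ∈ T :=
    ⟨vec n q (i + k) (j + l) 0 0, homP_vec_zero _ _⟩
  have ha : ∀ s t, tmul (vec n q i j s t) (unitS n q k l) ∈ T →
      tmul (vec n q i j s (t + 1)) (unitS n q k l) ∈ T := by
    intro s t h
    have h1 := (LinearMap.range f).smul_mem (a K n q) h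
    rw [a_smul_tmul, b_smul, a_smul, tmul_smul, tmul_zero, add_zero, a_smul_vec] at h1
    exact (T.smul_mem_iff (pow_ne_zero k hq0)).mp h1
  have hd : ∀ s t, tmul (vec n q i j s t) (unitS n q k l) ∈ T →
      tmul (vec n q i j (s + 1) t) (unitS n q k l) ∈ T := by
    intro s t h
    have h1 := (LinearMap.range f).smul_mem (d K n q) h
    rw [d_smul_tmul, c_smul, d_smul, tmul_smul, tmul_zero, add_zero, d_smul_vec] at h1
    exact (T.smul_mem_iff (pow_ne_zero l hq0)).mp h1
  have hst : ∀ s t, tmul (vec n q i j s t) (unitS n q k l) ∈ T := by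
    intro s t
    induction s with
    | zero =>
      induction t with
      | zero => exact h00
      | succ t ih => exact ha _ _ ih
    | succ s ih => exact hd _ _ ih
  have hsurj : Function.Surjective f := by
    refine LinearMap.range_eq_top.mp (tensor_eq_top fun m w => ?_)
    obtain ⟨r, rfl⟩ := eq_smul_unitS w
    rw [tmul_smul]
    refine T.smul_mem r ?_
    have : (⊤ : Submodule K (P n q i j)) ≤
        T.comap ((TensorProduct.mk K (P n q i j) (S K n q k l)).flip (unitS n q k l)) := by
      rw [← (basisP n q i j).span_eq, Submodule.span_le]
      rintro _ ⟨x, rfl⟩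
      rw [basisP_apply]
      exact hst _ _
    exact this (Submodule.mem_top : m ∈ ⊤)
  refine (greenClass_eq_of_surjective f hsurj ?_).symm
  rw [finrank_tensor, finrank_P, finrank_P, finrank_S, mul_one]

theorem greenClass_P (i j : ℕ) : greenClass (P n q i j) =
    greenClass (S K n q 1 0) ^ i * greenClass (S K n q 0 1) ^ j * greenClass (P n q 0 0) := by
  rw [← greenClass_S, greenClass_S_mul_P, add_zero, add_zero]

theorem greenClass_S_one_zero_pow : greenClass (S K n q 1 0) ^ n = 1 := by
  have := greenClass_S (K := K) (n := n) (q := q) n 0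
  rw [pow_zero, mul_one] at this
  rw [← this, ← greenClass_S_zero]
  exact greenClass_S_congr (by rw [hq.out.pow_eq_one, pow_zero]) rfl

theorem greenClass_S_zero_one_pow : greenClass (S K n q 0 1) ^ n = 1 := by
  have := greenClass_S (K := K) (n := n) (q := q) 0 n
  rw [pow_zero, one_mul] at this
  rw [← this, ← greenClass_S_zero]
  exact greenClass_S_congr rfl (by rw [hq.out.pow_eq_one, pow_zero])

/-- The weights of `P 0 0` are `(t, (n - 1) s)` with `s, t < n`, and these run once through all
pairs modulo `n`. -/
theorem greenClass_P_sq : greenClass (P n q 0 0) ^ 2 =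
    ∑ i ∈ Finset.range n, ∑ j ∈ Finset.range n,
      greenClass (S K n q 1 0) ^ i * greenClass (S K n q 0 1) ^ j * greenClass (P n q 0 0) := by
  rw [sq, greenClass_mul_P (basisP n q 0 0) (fun x => 0 + x.2) (fun x => 0 + (n - 1) * x.1)
    (fun x => by rw [basisP_apply]; exact vec_mem_weightSpace _ _)]
  simp only [zero_add, add_zero]
  rw [Fintype.sum_prod_type_right, ← Fin.sum_univ_eq_sum_range]
  refine Finset.sum_congr rfl fun t _ => ?_
  simp only [greenClass_P (_ : ℕ) (_ * _)]
  rw [← Finset.sum_mul, ← Finset.sum_mul, ← Finset.mul_sum, ← Finset.mul_sum,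
    Fin.sum_univ_eq_sum_range fun s => greenClass (S K n q 0 1) ^ ((n - 1) * s),
    sum_range_pow_pred_mul greenClass_S_zero_one_pow]

end TaftTensor

/-! ### Projective modules -/

namespace TaftTensor

variable {K : Type u} [Field K] {n : ℕ} {q : K} [NeZero n] [hq : Fact (IsPrimitiveRoot q n)]

/-- A nonzero finite-dimensional projective module maps onto some `P i j`. -/
theorem exists_surjective_P [IsAlgClosed K] (M : FDMod K (TaftTensor K n q)) [Nontrivial M]
    [Module.Projective (TaftTensor K n q) M] :
    ∃ (i j : ℕ) (f : M →ₗ[TaftTensor K n q] P n q i j), Function.Surjective f := by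
  have : Module.Finite (TaftTensor K n q) M :=
    Module.Finite.of_restrictScalars_finite K (TaftTensor K n q) M
  -- A maximal submodule exists by finite generation, and its quotient is some `S i j`; the
  -- projective cover property then lifts the surjection to `P i j`.
  obtain ⟨N, hN, -⟩ := (eq_top_or_exists_le_coatom
    (⊥ : Submodule (TaftTensor K n q) M)).resolve_left bot_ne_top
  have : IsSimpleModule (TaftTensor K n q) (FDMod.ofQuotient N) :=
    isSimpleModule_iff_isCoatom.mpr hN
  obtain ⟨i, j, ⟨e⟩⟩ := exists_equiv_S_of_isSimpleModule (FDMod.ofQuotient N)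
  have hsurj : Function.Surjective (e.toLinearMap ∘ₗ (N.mkQ : M →ₗ[_] FDMod.ofQuotient N)) :=
    e.surjective.comp N.mkQ_surjective
  exact ⟨i, j, isProjectiveCover_projP.exists_surjective _ hsurj⟩

/-- The class of a finite-dimensional projective module is a sum of classes of modules `P i j`. -/
theorem greenClass_mem_of_projective [IsAlgClosed K]
    (T : AddSubgroup (GreenRing K (TaftTensor K n q))) (hT : ∀ i j, greenClass (P n q i j) ∈ T)
    (M : FDMod K (TaftTensor K n q)) [Module.Projective (TaftTensor K n q) M] :
    greenClass M ∈ T := by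
  obtain ⟨r, hr⟩ : ∃ r, Module.finrank K M = r := ⟨_, rfl⟩
  induction r using Nat.strong_induction_on generalizing M with
  | h r ih =>
    rcases subsingleton_or_nontrivial M with _ | _
    · rw [greenClass_of_subsingleton]
      exact zero_mem T
    · obtain ⟨i, j, f, hf⟩ := exists_surjective_P M
      -- Splitting off `P i j` leaves the kernel, a direct summand and so projective, of dimension
      -- smaller by `n ^ 2`.
      rw [greenClass_eq_add_ker f hf]
      obtain ⟨e⟩ := exists_equiv_prod_ker_of_surjective f hf
      have hker : Module.Projective (TaftTensor K n q) (LinearMap.ker f) :=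
        Module.Projective.of_split (M := M)
          (e.symm.toLinearMap ∘ₗ LinearMap.inr _ _ (LinearMap.ker f))
          (LinearMap.snd _ _ (LinearMap.ker f) ∘ₗ e.toLinearMap) (by ext; simp)
      have : Module.Projective (TaftTensor K n q) (FDMod.ofSubmodule (LinearMap.ker f)) := hker
      have hd : Module.finrank K M =
          n * n + Module.finrank K (FDMod.ofSubmodule (LinearMap.ker f)) := by
        rw [← finrank_P (q := q) (i := i) (j := j),
          ← Module.finrank_prod (M := P n q i j) (M' := FDMod.ofSubmodule (LinearMap.ker f))]
        exact LinearEquiv.finrank_eq (e.restrictScalars K)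
      have hn : 0 < n * n := Nat.mul_pos (NeZero.pos n) (NeZero.pos n)
      exact add_mem (hT i j) (ih _ (by omega) (FDMod.ofSubmodule (LinearMap.ker f)) rfl)

end TaftTensor

/-! ### Linear independence of the classes of `S i j` and `P i j` -/

theorem Submodule.finrank_prod {K M N : Type*} [Field K] [AddCommGroup M] [Module K M]
    [AddCommGroup N] [Module K N] [Module.Finite K M] [Module.Finite K N] (U : Submodule K M)
    (W : Submodule K N) :
    Module.finrank K (U.prod W) = Module.finrank K U + Module.finrank K W := by
  rw [← Module.finrank_prod]
  exact LinearEquiv.finrank_eq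
    { toFun := fun x => (⟨x.1.1, x.2.1⟩, ⟨x.1.2, x.2.2⟩)
      invFun := fun x => ⟨(x.1.1, x.2.1), x.1.2, x.2.2⟩
      map_add' := fun _ _ => rfl
      map_smul' := fun _ _ => rfl
      left_inv := fun _ => rfl
      right_inv := fun _ => rfl }

namespace TaftTensor

variable {K : Type u} [Field K] {n : ℕ} {q : K} [NeZero n] [hq : Fact (IsPrimitiveRoot q n)]

/-- The image under `h` of the weight space of weight `(k, l)`. -/
def weightImage (h : TaftTensor K n q) (k l : ℕ) (M : FDMod K (TaftTensor K n q)) :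
    Submodule K M :=
  (weightSpace n q M k l).map (Algebra.lsmul K K M h)

theorem mem_weightImage {h : TaftTensor K n q} {k l : ℕ} {M : FDMod K (TaftTensor K n q)} {y : M} :
    y ∈ weightImage h k l M ↔ ∃ m ∈ weightSpace n q M k l, h • m = y := Iff.rfl

theorem finrank_weightImage_congr (h : TaftTensor K n q) (k l : ℕ)
    {M N : FDMod K (TaftTensor K n q)} (e : M ≃ₗ[TaftTensor K n q] N) :
    Module.finrank K (weightImage h k l M) = Module.finrank K (weightImage h k l N) := by
  have key : (weightImage h k l M).map (e.restrictScalars K).toLinearMap = weightImage h k l N := by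
    ext y
    rw [Submodule.mem_map]
    constructor
    · rintro ⟨_, ⟨m, hm, rfl⟩, rfl⟩
      exact ⟨e m, map_mem_weightSpace e.toLinearMap hm, (e.map_smul h m).symm⟩
    · rintro ⟨m, hm, rfl⟩
      refine ⟨h • e.symm m, ⟨e.symm m, map_mem_weightSpace e.symm.toLinearMap hm, rfl⟩, ?_⟩
      change e (h • e.symm m) = h • m
      rw [e.map_smul, e.apply_symm_apply]
  rw [← key]
  exact (LinearEquiv.finrank_map_eq (e.restrictScalars K) _).symm

theorem finrank_weightImage_directSum (h : TaftTensor K n q) (k l : ℕ)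
    (M N : FDMod K (TaftTensor K n q)) :
    Module.finrank K (weightImage h k l (M.directSum N)) =
      Module.finrank K (weightImage h k l M) + Module.finrank K (weightImage h k l N) := by
  have key : weightImage h k l (M.directSum N) =
      (weightImage h k l M).prod (weightImage h k l N) := by
    ext y
    rw [mem_weightImage]
    refine Iff.trans ?_ Submodule.mem_prod.symm
    rw [mem_weightImage, mem_weightImage]
    constructor
    · rintro ⟨m, hm, rfl⟩
      exact ⟨⟨m.1, ⟨congrArg Prod.fst hm.1, congrArg Prod.fst hm.2⟩, rfl⟩,
        ⟨m.2, ⟨congrArg Prod.snd hm.1, congrArg Prod.snd hm.2⟩, rfl⟩⟩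
    · rintro ⟨⟨m, hm, h1⟩, ⟨m', hm', h2⟩⟩
      exact ⟨(m, m'), ⟨Prod.ext hm.1 hm'.1, Prod.ext hm.2 hm'.2⟩, Prod.ext h1 h2⟩
  rw [key]
  exact Submodule.finrank_prod (weightImage h k l M) (weightImage h k l N)

/-- The dimension of `weightImage h k l` as a function on the Green ring. -/
def weightRank (h : TaftTensor K n q) (k l : ℕ) : GreenRing K (TaftTensor K n q) →+ ℤ :=
  greenLift (fun M => Module.finrank K (weightImage h k l M))
    (fun _ _ e => congrArg _ (finrank_weightImage_congr h k l e))
    (fun M N => by rw [finrank_weightImage_directSum, Nat.cast_add])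

theorem weightRank_greenClass (h : TaftTensor K n q) (k l : ℕ) (M : FDMod K (TaftTensor K n q)) :
    weightRank h k l (greenClass M) = Module.finrank K (weightImage h k l M) :=
  greenLift_greenClass _ _ _ M

theorem weightRank_one_S (i j k l : Fin n) :
    weightRank 1 k l (greenClass (S K n q i j)) = if (i, j) = (k, l) then 1 else 0 := by
  rw [weightRank_greenClass]
  split_ifs with h
  · obtain ⟨rfl, rfl⟩ := Prod.mk.inj h
    have : weightImage 1 i j (S K n q i j) = ⊤ := by
      refine eq_top_iff.mpr fun v _ => ⟨v, ?_, one_smul _ v⟩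
      exact ⟨b_smul K n q i j v, c_smul K n q i j v⟩
    rw [this, finrank_top, finrank_S, Nat.cast_one]
  · have : weightImage 1 k l (S K n q i j) = ⊥ := by
      refine eq_bot_iff.mpr ?_
      rintro _ ⟨v, hv, rfl⟩
      by_contra hv0
      have hv0 : v ≠ 0 := fun h => hv0 (by rw [h]; simp)
      refine h (Prod.ext (Fin.ext ?_) (Fin.ext ?_))
      · exact hq.out.pow_inj i.2 k.2
          (smul_left_injective K hv0 ((b_smul K n q i j v).symm.trans hv.1))
      · exact hq.out.pow_inj j.2 l.2
          (smul_left_injective K hv0 ((c_smul K n q i j v).symm.trans hv.2))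
    rw [this, finrank_bot, Nat.cast_zero]

variable (K n q) in
/-- The element `d ^ (n - 1) a ^ (n - 1)`. -/
def topElement : TaftTensor K n q := d K n q ^ (n - 1) * a K n q ^ (n - 1)

/-- For `n > 1` the factor `a ^ (n - 1)` involves `a`, which kills `S i j`. -/
theorem weightRank_topElement_S (hn : 1 < n) (i j k l : ℕ) :
    weightRank (topElement K n q) k l (greenClass (S K n q i j)) = 0 := by
  rw [weightRank_greenClass]
  have : weightImage (topElement K n q) k l (S K n q i j) = ⊥ := by
    refine eq_bot_iff.mpr ?_
    rintro _ ⟨v, hv, rfl⟩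
    change topElement K n q • v = 0
    rw [topElement, mul_smul, show n - 1 = n - 2 + 1 by omega, pow_succ (a K n q), mul_smul,
      a_smul, smul_zero, smul_zero]
  rw [this, finrank_bot, Nat.cast_zero]

/-- Every basis vector other than the generator is pushed out of range in `s` or in `t`. -/
theorem topElement_smul_P {i j : ℕ} (p : P n q i j) :
    topElement K n q • p = (basisP n q i j).repr p (0, 0) • vec n q i j (n - 1) (n - 1) := by
  classical
  have : Algebra.lsmul K K (P n q i j) (topElement K n q) =
      ((basisP n q i j).coord (0, 0)).smulRight (vec n q i j (n - 1) (n - 1)) := by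
    refine (basisP n q i j).ext fun x => ?_
    rw [LinearMap.smulRight_apply, Module.Basis.coord_apply, Module.Basis.repr_self,
      Finsupp.single_apply]
    have h1 : Algebra.lsmul K K (P n q i j) (topElement K n q) (basisP n q i j x) =
        vec n q i j (x.1 + (n - 1)) (x.2 + (n - 1)) := by
      rw [basisP_apply, ← pow_smul_vec, ← mul_smul]
      rfl
    rw [h1]
    split_ifs with hx
    · subst hx; simp
    · rw [zero_smul]
      by_cases h0 : x.1 = 0
      · refine vec_of_le_right ?_
        have : (x.2 : ℕ) ≠ 0 := fun h => hx (Prod.ext h0 (Fin.ext (by simpa using h)))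
        omega
      · refine vec_of_le_left ?_
        have : (x.1 : ℕ) ≠ 0 := fun h => h0 (Fin.ext (by simpa using h))
        omega
  exact LinearMap.congr_fun this p

/-- The top element sees only the coordinate at the generator, and that coordinate vanishes on all
other weight spaces. -/
theorem weightRank_topElement_P (i j k l : Fin n) :
    weightRank (topElement K n q) k l (greenClass (P n q i j)) =
      if (i, j) = (k, l) then 1 else 0 := by
  have hn := NeZero.pos n
  rw [weightRank_greenClass]
  split_ifs with h
  · obtain ⟨rfl, rfl⟩ := Prod.mk.inj h
    have hne : vec n q i j (n - 1) (n - 1) ≠ 0 := by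
      have := (basisP n q i j).ne_zero (⟨n - 1, by omega⟩, ⟨n - 1, by omega⟩)
      rwa [basisP_apply] at this
    have : weightImage (topElement K n q) i j (P n q i j) =
        Submodule.span K {vec n q i j (n - 1) (n - 1)} := by
      apply le_antisymm
      · rintro _ ⟨p, -, rfl⟩
        change topElement K n q • p ∈ _
        rw [topElement_smul_P]
        exact Submodule.smul_mem _ _ (Submodule.mem_span_singleton_self _)
      · rw [Submodule.span_singleton_le_iff_mem]
        refine ⟨vec n q i j 0 0, vec_zero_mem_weightSpace, ?_⟩
        change topElement K n q • vec n q i j 0 0 = _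
        rw [topElement, mul_smul, pow_smul_vec, zero_add]
    rw [this, finrank_span_singleton hne, Nat.cast_one]
  · have : weightImage (topElement K n q) k l (P n q i j) = ⊥ := by
      refine eq_bot_iff.mpr ?_
      rintro _ ⟨p, hp, rfl⟩
      change topElement K n q • p = 0
      rw [topElement_smul_P, repr_eq_zero_of_mem_weightSpace hp, zero_smul]
      rintro ⟨h1, h2⟩
      refine h (Prod.ext (Fin.ext (hq.out.pow_inj i.2 k.2 ?_))
        (Fin.ext (hq.out.pow_inj j.2 l.2 ?_)))
      · simpa using h1
      · simpa using h2
    rw [this, finrank_bot, Nat.cast_zero]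

/-- The system is triangular: `topElement` kills all `[S i j]` and reads off `β`; once `β = 0`, the
weight multiplicities read off `α`. -/
theorem eq_zero_of_sum_greenClass_eq_zero (hn : 1 < n) (α β : Fin n × Fin n → ℤ)
    (h : ∑ x, α x • greenClass (S K n q x.1 x.2) + ∑ x, β x • greenClass (P n q x.1 x.2) = 0) :
    α = 0 ∧ β = 0 := by
  have hβ : β = 0 := by
    funext x
    have := congrArg (weightRank (topElement K n q) x.1 x.2) h
    simp only [map_add, map_sum, map_zsmul, weightRank_topElement_S hn, weightRank_topElement_P,
      map_zero] at this
    simpa using this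
  refine ⟨?_, hβ⟩
  funext x
  have := congrArg (weightRank 1 x.1 x.2) h
  simp only [map_add, map_sum, map_zsmul, weightRank_one_S, hβ, Pi.zero_apply, zero_smul,
    Finset.sum_const_zero, add_zero, map_zero] at this
  simpa using this

end TaftTensor

/-! ### The presentation -/

/-- Evaluation of polynomials at a family of pairwise commuting elements of a ring. -/
theorem MvPolynomial.exists_ringHom_of_commute {R σ : Type*} [Ring R] (f : σ → R)
    (h : ∀ i j, Commute (f i) (f j)) :
    ∃ ψ : MvPolynomial σ ℤ →+* R, ∀ i, ψ (MvPolynomial.X i) = f i := by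
  -- The subring generated by commuting elements is commutative, so evaluation takes place there.
  have hcomm : IsMulCommutative (Subring.closure (Set.range f)) :=
    Subring.isMulCommutative_closure (by
      rintro _ ⟨i, rfl⟩ _ ⟨j, rfl⟩
      exact h i j)
  let _ : CommRing (Subring.closure (Set.range f)) :=
    { (inferInstance : Ring (Subring.closure (Set.range f))) with
      mul_comm := hcomm.is_comm.comm }
  let ψ : MvPolynomial σ ℤ →+* Subring.closure (Set.range f) :=
    MvPolynomial.eval₂Hom (Int.castRingHom _)
      fun i => ⟨f i, Subring.subset_closure (Set.mem_range_self i)⟩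
  refine ⟨(Subring.closure (Set.range f)).subtype.comp ψ, fun i => ?_⟩
  rw [RingHom.comp_apply, MvPolynomial.eval₂Hom_X']
  rfl

section spanning

open MvPolynomial

variable (n : ℕ)

/-- The residue class of a variable in the presented ring. -/
def presentationVar (k : Fin 3) : MvPolynomial (Fin 3) ℤ ⧸ presentationIdeal n :=
  Ideal.Quotient.mk _ (X k)

theorem presentationVar_zero_pow : presentationVar n 0 ^ n = 1 := by
  rw [presentationVar, ← map_pow, ← map_one (Ideal.Quotient.mk (presentationIdeal n)),
    Ideal.Quotient.mk_eq_mk_iff_sub_mem]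
  exact Ideal.subset_span (by simp)

theorem presentationVar_one_pow : presentationVar n 1 ^ n = 1 := by
  rw [presentationVar, ← map_pow, ← map_one (Ideal.Quotient.mk (presentationIdeal n)),
    Ideal.Quotient.mk_eq_mk_iff_sub_mem]
  exact Ideal.subset_span (by simp)

theorem presentationVar_two_sq : presentationVar n 2 ^ 2 =
    ∑ i ∈ Finset.range n, ∑ j ∈ Finset.range n,
      presentationVar n 0 ^ i * presentationVar n 1 ^ j * presentationVar n 2 := by
  simp only [presentationVar, ← map_pow, ← map_mul, ← map_sum]
  rw [Ideal.Quotient.mk_eq_mk_iff_sub_mem]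
  exact Ideal.subset_span (by simp)

/-- The monomials `x ^ i y ^ j` and `x ^ i y ^ j z` with `i, j < n`. -/
def presentationMonomial :
    (Fin n × Fin n) ⊕ (Fin n × Fin n) → MvPolynomial (Fin 3) ℤ ⧸ presentationIdeal n :=
  Sum.elim (fun w => presentationVar n 0 ^ (w.1 : ℕ) * presentationVar n 1 ^ (w.2 : ℕ))
    (fun w => presentationVar n 0 ^ (w.1 : ℕ) * presentationVar n 1 ^ (w.2 : ℕ) *
      presentationVar n 2)

/-- The monomials `x ^ i y ^ j` and `x ^ i y ^ j z` with `i, j < n` span the presented ring. -/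
theorem span_presentationMonomial [NeZero n] :
    Submodule.span ℤ (Set.range (presentationMonomial n)) = ⊤ := by
  set x := presentationVar n 0 with hx
  set y := presentationVar n 1 with hy
  set z := presentationVar n 2 with hz
  set G := Submodule.span ℤ (Set.range (presentationMonomial n)) with hG
  have hmod : ∀ (w : MvPolynomial (Fin 3) ℤ ⧸ presentationIdeal n), w ^ n = 1 → ∀ i,
      w ^ i = w ^ (i % n) := fun w hw i => by
    conv_lhs => rw [← Nat.div_add_mod i n, pow_add, pow_mul, hw, one_pow, one_mul]
  have hxn := hmod x (presentationVar_zero_pow n)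
  have hyn := hmod y (presentationVar_one_pow n)
  have hlt : ∀ i, i % n < n := fun i => Nat.mod_lt _ (NeZero.pos n)
  have hG1 : ∀ i j : ℕ, x ^ i * y ^ j ∈ G := fun i j => by
    rw [hxn, hyn]
    exact Submodule.subset_span ⟨Sum.inl (⟨_, hlt i⟩, ⟨_, hlt j⟩), rfl⟩
  have hG2 : ∀ i j : ℕ, x ^ i * y ^ j * z ∈ G := fun i j => by
    rw [hxn, hyn]
    exact Submodule.subset_span ⟨Sum.inr (⟨_, hlt i⟩, ⟨_, hlt j⟩), rfl⟩
  -- A span that contains `1` and is stable under multiplication by each variable contains all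
  -- polynomials; only `z · z` uses the quadratic relation.
  have hmul : ∀ (k : Fin 3), G ≤ G.comap (LinearMap.mulRight ℤ (presentationVar n k)) := by
    intro k
    rw [hG, Submodule.span_le]
    rintro _ ⟨w | w, rfl⟩
    · change x ^ (w.1 : ℕ) * y ^ (w.2 : ℕ) * presentationVar n k ∈ G
      fin_cases k
      · convert hG1 (w.1 + 1) w.2 using 1
        change x ^ (w.1 : ℕ) * y ^ (w.2 : ℕ) * x = _
        ring
      · convert hG1 w.1 (w.2 + 1) using 1
        change x ^ (w.1 : ℕ) * y ^ (w.2 : ℕ) * y = _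
        ring
      · exact hG2 w.1 w.2
    · change x ^ (w.1 : ℕ) * y ^ (w.2 : ℕ) * z * presentationVar n k ∈ G
      fin_cases k
      · convert hG2 (w.1 + 1) w.2 using 1
        change x ^ (w.1 : ℕ) * y ^ (w.2 : ℕ) * z * x = _
        ring
      · convert hG2 w.1 (w.2 + 1) using 1
        change x ^ (w.1 : ℕ) * y ^ (w.2 : ℕ) * z * y = _
        ring
      · change x ^ (w.1 : ℕ) * y ^ (w.2 : ℕ) * z * z ∈ G
        rw [mul_assoc, ← sq, hz, presentationVar_two_sq, Finset.mul_sum]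
        refine G.sum_mem fun i _ => ?_
        rw [Finset.mul_sum]
        refine G.sum_mem fun j _ => ?_
        convert hG2 (w.1 + i) (w.2 + j) using 1
        ring
  refine eq_top_iff.mpr fun p _ => ?_
  obtain ⟨p, rfl⟩ := Ideal.Quotient.mk_surjective p
  induction p using MvPolynomial.induction_on with
  | C r =>
    have : Ideal.Quotient.mk (presentationIdeal n) (C r) = r • (x ^ 0 * y ^ 0) := by
      simp
    rw [this]
    exact G.smul_mem r (hG1 0 0)
  | add p p' hp hp' => rw [map_add]; exact G.add_mem (hp trivial) (hp' trivial)
  | mul_X p k hp => rw [map_mul]; exact hmul k (hp trivial)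

end spanning

namespace TaftTensor

variable {K : Type u} [Field K] {n : ℕ} {q : K} [NeZero n] [hq : Fact (IsPrimitiveRoot q n)]

variable (n q) in
/-- The classes `[S 1 0]`, `[S 0 1]` and `[P 0 0]`. -/
def generator : Fin 3 → GreenRing K (TaftTensor K n q) :=
  ![greenClass (S K n q 1 0), greenClass (S K n q 0 1), greenClass (P n q 0 0)]

/-- This permits evaluating polynomials in a Green ring whose commutativity is not available. -/
theorem commute_generator (i j : Fin 3) : Commute (generator n q i) (generator n q j) := by
  have h01 : Commute (greenClass (S K n q 1 0)) (greenClass (S K n q 0 1)) := by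
    rw [commute_iff_eq, greenClass_S_mul_S, greenClass_S_mul_S]
  have h02 : Commute (greenClass (S K n q 1 0)) (greenClass (P n q 0 0)) := by
    rw [commute_iff_eq, greenClass_S_mul_P, greenClass_P_mul_S]
  have h12 : Commute (greenClass (S K n q 0 1)) (greenClass (P n q 0 0)) := by
    rw [commute_iff_eq, greenClass_S_mul_P, greenClass_P_mul_S]
  fin_cases i <;> fin_cases j
  exacts [Commute.refl _, h01, h02, h01.symm, Commute.refl _, h12, h02.symm, h12.symm,
    Commute.refl _]

section presentation

variable {ψ : MvPolynomial (Fin 3) ℤ →+* GreenRing K (TaftTensor K n q)}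

theorem presentationIdeal_le_ker (hψ : ∀ i, ψ (MvPolynomial.X i) = generator n q i) :
    presentationIdeal n ≤ RingHom.ker ψ := by
  rw [presentationIdeal, Ideal.span_le]
  rintro _ (rfl | rfl | rfl)
  · rw [SetLike.mem_coe, RingHom.mem_ker, map_sub, map_pow, map_one, hψ, sub_eq_zero]
    exact greenClass_S_one_zero_pow
  · rw [SetLike.mem_coe, RingHom.mem_ker, map_sub, map_pow, map_one, hψ, sub_eq_zero]
    exact greenClass_S_zero_one_pow
  · rw [SetLike.mem_coe, RingHom.mem_ker, map_sub, sub_eq_zero]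
    simp only [map_pow, map_sum, map_mul, hψ]
    exact greenClass_P_sq

/-- The spanning monomials map to the independent classes `[S i j]` and `[P i j]`, so the induced
map on the quotient is injective. -/
theorem ker_eq_presentationIdeal (hn : 1 < n)
    (hψ : ∀ i, ψ (MvPolynomial.X i) = generator n q i) :
    RingHom.ker ψ = presentationIdeal n := by
  refine le_antisymm (fun p hp => ?_) (presentationIdeal_le_ker hψ)
  have hle := presentationIdeal_le_ker hψ
  let φ : MvPolynomial (Fin 3) ℤ ⧸ presentationIdeal n →+* GreenRing K (TaftTensor K n q) :=
    Ideal.Quotient.lift _ ψ hle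
  have hφ : ∀ k, φ (presentationVar n k) = generator n q k := fun k =>
    (Ideal.Quotient.lift_mk _ _ _).trans (hψ k)
  obtain ⟨w, hw⟩ := (Submodule.mem_span_range_iff_exists_fun ℤ).mp
    (span_presentationMonomial n ▸ Submodule.mem_top :
      Ideal.Quotient.mk (presentationIdeal n) p ∈ _)
  have h0 : φ (Ideal.Quotient.mk _ p) = 0 := (Ideal.Quotient.lift_mk _ _ _).trans hp
  rw [← hw, map_sum, Fintype.sum_sum_type] at h0
  simp only [map_zsmul, presentationMonomial, Sum.elim_inl, Sum.elim_inr, map_mul, map_pow,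
    hφ] at h0
  obtain ⟨h1, h2⟩ := eq_zero_of_sum_greenClass_eq_zero (K := K) (q := q) hn
    (fun x => w (Sum.inl x)) (fun x => w (Sum.inr x)) (by
      simp only [greenClass_S (_ : Fin n).val, greenClass_P (_ : Fin n).val]
      exact h0)
  rw [← Ideal.Quotient.eq_zero_iff_mem, ← hw, Fintype.sum_sum_type]
  rw [Finset.sum_eq_zero fun x _ => ?_, Finset.sum_eq_zero fun x _ => ?_, add_zero]
  · rw [show w (Sum.inr x) = 0 from congrFun h2 x, zero_smul]
  · rw [show w (Sum.inl x) = 0 from congrFun h1 x, zero_smul]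

/-- Each simple class is a monomial `x ^ i y ^ j`, and each projective class is a sum of monomials
`x ^ i y ^ j z`. -/
theorem range_eq_projectiveClassRing [IsAlgClosed K]
    (hψ : ∀ i, ψ (MvPolynomial.X i) = generator n q i) :
    ψ.range = projectiveClassRing K (TaftTensor K n q) := by
  have h0 : ψ (MvPolynomial.X 0) = greenClass (S K n q 1 0) := hψ 0
  have h1 : ψ (MvPolynomial.X 1) = greenClass (S K n q 0 1) := hψ 1
  have h2 : ψ (MvPolynomial.X 2) = greenClass (P n q 0 0) := hψ 2
  apply le_antisymm
  · rintro _ ⟨p, rfl⟩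
    induction p using MvPolynomial.induction_on with
    | C r =>
      rw [show (MvPolynomial.C r : MvPolynomial (Fin 3) ℤ) = (r : MvPolynomial (Fin 3) ℤ) by simp,
        map_intCast]
      exact intCast_mem _ r
    | add p p' hp hp' => rw [map_add]; exact add_mem hp hp'
    | mul_X p k hp =>
      rw [map_mul]
      refine mul_mem hp (Subring.subset_closure ?_)
      fin_cases k
      · exact ⟨_, Or.inr inferInstance, h0⟩
      · exact ⟨_, Or.inr inferInstance, h1⟩
      · exact ⟨_, Or.inl inferInstance, h2⟩
  · rw [projectiveClassRing, Subring.closure_le]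
    have hS : ∀ i j, greenClass (S K n q i j) ∈ ψ.range := fun i j => by
      rw [greenClass_S, ← h0, ← h1, ← map_pow, ← map_pow, ← map_mul]
      exact ⟨_, rfl⟩
    rintro _ ⟨M, hM | hM, rfl⟩
    · refine greenClass_mem_of_projective ψ.range.toAddSubgroup (fun i j => ?_) M
      rw [greenClass_P, ← greenClass_S, ← h2]
      exact ψ.range.mul_mem (hS i j) ⟨_, rfl⟩
    · obtain ⟨i, j, ⟨e⟩⟩ := exists_equiv_S_of_isSimpleModule M
      rw [greenClass_congr e]
      exact hS i j

end presentation

end TaftTensor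
end

theorem theorem3p8 {K : Type*} [Field K] [IsAlgClosed K] (n : ℕ) [NeZero n] (hn : 2 < n)
    (q : K) [Fact (IsPrimitiveRoot q n)] :
    ∃ e : (MvPolynomial (Fin 3) ℤ ⧸ presentationIdeal n) ≃+*
        projectiveClassRing K (TaftTensor K n q),
      (e (Ideal.Quotient.mk _ (MvPolynomial.X 0)) : GreenRing K (TaftTensor K n q)) =
          greenClass (TaftTensor.S K n q 1 0) ∧
      (e (Ideal.Quotient.mk _ (MvPolynomial.X 1)) : GreenRing K (TaftTensor K n q)) =
          greenClass (TaftTensor.S K n q 0 1) ∧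
      (∃ (P : FDMod K (TaftTensor K n q))
          (π : P →ₗ[TaftTensor K n q] TaftTensor.S K n q 0 0), IsProjectiveCover π) ∧
      ∀ (P : FDMod K (TaftTensor K n q)) (π : P →ₗ[TaftTensor K n q] TaftTensor.S K n q 0 0),
        IsProjectiveCover π →
          (e (Ideal.Quotient.mk _ (MvPolynomial.X 2)) : GreenRing K (TaftTensor K n q)) =
            greenClass P := by
  obtain ⟨ψ, hψ⟩ := MvPolynomial.exists_ringHom_of_commute (TaftTensor.generator n q)
    TaftTensor.commute_generator
  let e := ((Ideal.quotEquivOfEq (TaftTensor.ker_eq_presentationIdeal (by omega) hψ).symm).trans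
    (RingHom.quotientKerEquivRange ψ)).trans
    (RingEquiv.subringCongr (TaftTensor.range_eq_projectiveClassRing hψ))
  have he : ∀ i, (e (Ideal.Quotient.mk _ (MvPolynomial.X i)) : GreenRing K (TaftTensor K n q)) =
      TaftTensor.generator n q i := hψ
  refine ⟨e, he 0, he 1, ⟨_, _, TaftTensor.isProjectiveCover_projP⟩, fun P π hπ => ?_⟩
  -- The variable `z` goes to the explicit module `P 0 0`; uniqueness of projective covers passes to
  -- an arbitrary one.
  rw [he 2]
  exact TaftTensor.isProjectiveCover_projP.greenClass_eq hπ
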